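/- Let $n,d$ be coprime positive integers and let $a\ge 0$ be real. Let $CH(n,d,a)\subset\mathbb R^2$ be the cyclic-harmonic curve with polar equation $\rho=\cos\left(\frac nd\varphi\right)+a$, $\varphi\in[0,2d\pi]$ (with signed radius $\rho$), i.e. the set of points $(\rho\cos\varphi,\rho\sin\varphi)$. Then the polynomials in $\mathbb C[x,y]$ vanishing on $CH(n,d,a)$ form a principal ideal $(f)$. View $CH(n,d,a)$ as the algebraic curve $f=0$. Call $\deg f$ its order, and call a point of the complex projective plane an $m$-fold point of the curve (a point of multiplicity $m$) if the Taylor expansion of the homogenization of $f$ at that point starts with terms of degree exactly $m$. With $x=x_1/x_0$, $y=x_2/x_0$, the origin is $O=(1:0:0)$ and the absolute (circular) points are $(0:1:\pm i)$. 1. If $a=0$ and $n\cdot d$ is odd, then $CH(n,d,a)$ has order $n+d$, the origin has multiplicity $n$, and each of the two absolute points has multiplicity $d$ if $d<n$ and $\frac{n+d}{2}$ if $d>n$. 2. In all other cases, $CH(n,d,a)$ has order $2(n+d)$, the origin has multiplicity $2n$, and each of the two absolute points has multiplicity $2d$ if $d<n$ and $n+d$ if $d>n$. -/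

import Mathlib

open MvPolynomial

/-- The cyclic-harmonic curve `ρ = cos (n φ / d) + a`, `φ ∈ [0, 2 d π]`, as a set of points of the
real Cartesian plane (the radius `ρ` is signed). -/
def cyclicHarmonicCurve (n d : ℕ) (a : ℝ) : Set (Fin 2 → ℝ) :=
  {p | ∃ φ ∈ Set.Icc (0 : ℝ) (2 * d * Real.pi),
    p = ![(Real.cos ((n : ℝ) / d * φ) + a) * Real.cos φ,
          (Real.cos ((n : ℝ) / d * φ) + a) * Real.sin φ]}

/-- `f` is an equation of the algebraic curve carrying the real point set `S`, that is, of its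
Zariski closure in the complex affine plane: the polynomials vanishing on `S` are exactly the
multiples of `f`. Such an `f` is unique up to a nonzero constant factor. -/
def IsCurveEquation (S : Set (Fin 2 → ℝ)) (f : MvPolynomial (Fin 2) ℂ) : Prop :=
  MvPolynomial.vanishingIdeal ℂ ((fun (p : Fin 2 → ℝ) (i : Fin 2) => (p i : ℂ)) '' S) =
    Ideal.span {f}

/-- The homogenization `x₀ ^ deg f * f (x₁ / x₀, x₂ / x₀)` of a polynomial in two variables:
the equation of the projective closure of the curve `f = 0`. -/
noncomputable def homogenization (f : MvPolynomial (Fin 2) ℂ) : MvPolynomial (Fin 3) ℂ :=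
  ∑ k ∈ Finset.range (f.totalDegree + 1),
    X 0 ^ (f.totalDegree - k) * rename Fin.succ (homogeneousComponent k f)

/-- The point with homogeneous coordinates `p` is an `m`-fold point of the projective plane curve
`F = 0`: the Taylor expansion of `F` at `p` starts with terms of degree exactly `m`. Equivalently,
all partial derivatives of `F` of order less than `m` vanish at `p`, and some partial derivative of
order `m` does not. For homogeneous `F` and nonzero `p` this depends only on the projective point,
and it agrees with the multiplicity computed in any affine chart containing that point. -/
def IsFoldPoint (m : ℕ) (F : MvPolynomial (Fin 3) ℂ) (p : Fin 3 → ℂ) : Prop :=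
  (∀ k < m, homogeneousComponent k (bind₁ (fun i => X i + C (p i)) F) = 0) ∧
    homogeneousComponent m (bind₁ (fun i => X i + C (p i)) F) ≠ 0

/-- The homogeneous coordinates `(x₀, x₁, x₂)` of the origin `x = y = 0`,
where `x = x₁ / x₀` and `y = x₂ / x₀`. -/
def originPoint : Fin 3 → ℂ := ![1, 0, 0]

/-- The homogeneous coordinates of the two absolute (circular) points
`(0 : 1 : i)` and `(0 : 1 : -i)`. -/
def absolutePoints : Set (Fin 3 → ℂ) := {![0, 1, Complex.I], ![0, 1, -Complex.I]}

/-! Put `z = x + iy`, `w = x - iy`, `φ = dθ`, `t = exp(iθ)`. On the curve `z = ρ t^d` and `w = ρ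
t^(-d)`, so `zw = ρ²`, and `T_d(cos nθ) = cos(ndθ)` gives `z^n + w^n = G(ρ)` with `G(ρ) = 2 ρ^n
T_d(ρ - a)`. If `a = 0` and `n`, `d` are odd, `G` is even and this is already an equation in `z^n +
w^n` and `zw` (weight `m = 1`). Otherwise `ρ` is eliminated by the norm `(S - G(ρ))(S - G(-ρ))`, `S
= z^n + w^n` (weight `m = 2`).

All exponents of `G` lie between `n` and `n + d`. The resulting bounds, collected in
`IsPolarFamily`, determine the degree and the multiplicities: they bound the order along every line
from below, and one well-chosen line attains the bound.

The equation generates the whole ideal (`IsPolarFamily.dvd_of_mem_vanishingIdeal`) by a root count.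
After `z = vw` it becomes `w^(nm) Q(v, w)` with `Q` of degree `dm` in `w`. Over `v = t^(2d)` the
parameters `ζt`, `ζ^(dm) = 1`, give `dm` distinct roots for almost all `t`; coprimality and the case
distinction enter here, through `SeparatesRoots`. If `g` vanishes on the curve, its pseudo-remainder
modulo `Q` has degree below `dm` in `w` but `dm` roots over infinitely many `v`, so it is zero. The
extra factors are constants and powers of `z` and `w`, which are prime to the equation. -/

section LineRestriction

/-! ### Order at a point by restriction to lines -/

variable {σ : Type*}

lemma coeff_aeval_C_mul_X (F : MvPolynomial σ ℂ) (q : σ → ℂ) (k : ℕ) :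
    (aeval (fun i => Polynomial.C (q i) * Polynomial.X) F).coeff k =
      eval q (homogeneousComponent k F) := by
  classical
  induction F using MvPolynomial.induction_on' with
  | add p q hp hq => simp [hp, hq]
  | monomial s c =>
    have h : aeval (fun i => Polynomial.C (q i) * Polynomial.X) (monomial s c) =
        Polynomial.C (eval q (monomial s c)) * Polynomial.X ^ s.degree := by
      rw [aeval_monomial, eval_monomial]
      simp only [mul_pow, Finsupp.prod, Finset.prod_mul_distrib, map_mul, map_prod, map_pow,
        Finset.prod_pow_eq_pow_sum, Finsupp.degree, mul_assoc]
      rfl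
    rw [h, Polynomial.coeff_C_mul_X_pow,
      homogeneousComponent_of_mem (isHomogeneous_monomial c rfl : _ ∈ homogeneousSubmodule _ _ _)]
    split_ifs <;> simp

/-- The order of a polynomial at a point is the order of its restriction to a generic line. -/
lemma isFoldPoint_of_lines {m : ℕ} {F : MvPolynomial (Fin 3) ℂ} {p : Fin 3 → ℂ}
    (hdvd : ∀ q : Fin 3 → ℂ, Polynomial.X ^ m ∣
      aeval (fun i => Polynomial.C (p i) + Polynomial.C (q i) * Polynomial.X) F)
    (hne : ∃ q : Fin 3 → ℂ,
      (aeval (fun i => Polynomial.C (p i) + Polynomial.C (q i) * Polynomial.X) F).coeff m ≠ 0) :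
    IsFoldPoint m F p := by
  have key : ∀ (q : Fin 3 → ℂ) (k : ℕ),
      (aeval (fun i => Polynomial.C (p i) + Polynomial.C (q i) * Polynomial.X) F).coeff k =
        eval q (homogeneousComponent k (bind₁ (fun i => X i + C (p i)) F)) := by
    intro q k
    rw [← coeff_aeval_C_mul_X, aeval_bind₁]
    congr 3
    ext1 i
    simp [add_comm]
  constructor
  · intro k hk
    refine MvPolynomial.funext fun q => ?_
    rw [← key, map_zero]
    exact Polynomial.X_pow_dvd_iff.mp (hdvd q) k hk
  · obtain ⟨q, hq⟩ := hne
    rw [key] at hq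
    rintro h
    simp [h] at hq

end LineRestriction

/-! ### Homogenization as a linear map -/

section Homogenization

/-- Homogenization of polynomials in two variables of degree at most `D` to forms of degree `D`. -/
noncomputable def homogenizeAt (D : ℕ) : MvPolynomial (Fin 2) ℂ →ₗ[ℂ] MvPolynomial (Fin 3) ℂ :=
  ∑ k ∈ Finset.range (D + 1), LinearMap.mulLeft ℂ (X 0 ^ (D - k)) ∘ₗ
    (rename Fin.succ).toLinearMap ∘ₗ homogeneousComponent k

lemma homogenization_eq_homogenizeAt (f : MvPolynomial (Fin 2) ℂ) :
    homogenization f = homogenizeAt f.totalDegree f := by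
  simp [homogenization, homogenizeAt]

lemma homogenizeAt_of_isHomogeneous {D k : ℕ} {f : MvPolynomial (Fin 2) ℂ}
    (hf : f.IsHomogeneous k) (hk : k ≤ D) :
    homogenizeAt D f = X 0 ^ (D - k) * rename Fin.succ f := by
  simp only [homogenizeAt, LinearMap.coe_sum, Finset.sum_apply, LinearMap.comp_apply,
    LinearMap.mulLeft_apply, AlgHom.toLinearMap_apply]
  rw [Finset.sum_eq_single_of_mem k (by simp; omega)]
  · rw [homogeneousComponent_of_mem hf, if_pos rfl]
  · intro j _ hj
    rw [homogeneousComponent_of_mem hf, if_neg hj, map_zero, mul_zero]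

lemma homogenization_C_mul {c : ℂ} (hc : c ≠ 0) (f : MvPolynomial (Fin 2) ℂ) :
    homogenization (C c * f) = C c * homogenization f := by
  have h : (C c * f).totalDegree = f.totalDegree := by
    by_cases hf : f = 0
    · simp [hf]
    · rw [totalDegree_mul_of_isDomain (by simpa using hc) hf, totalDegree_C, zero_add]
  rw [homogenization_eq_homogenizeAt, homogenization_eq_homogenizeAt, h, ← smul_eq_C_mul,
    ← smul_eq_C_mul, map_smul]

lemma IsFoldPoint.C_mul {m : ℕ} {F : MvPolynomial (Fin 3) ℂ} {p : Fin 3 → ℂ} {c : ℂ} (hc : c ≠ 0)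
    (h : IsFoldPoint m F p) : IsFoldPoint m (C c * F) p := by
  refine ⟨fun k hk => ?_, ?_⟩
  · rw [map_mul, bind₁_C_right, homogeneousComponent_C_mul, h.1 k hk, mul_zero]
  · rw [map_mul, bind₁_C_right, homogeneousComponent_C_mul]
    exact mul_ne_zero (by simpa using hc) h.2

end Homogenization

/-! ### Polar forms: degree and multiplicities from exponent bounds -/

/-- The form `∑ Pₖ,ⱼ h ^ (dm + nk - 2j) (z ^ n + w ^ n) ^ (m - k) (z w) ^ j`, where `Pₖ,ⱼ` are the
coefficients of the polynomial `Pₖ`. -/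
noncomputable def polarForm {A : Type*} [CommRing A] [Algebra ℂ A] (n d m M : ℕ)
    (P : ℕ → Polynomial ℂ) (h z w : A) : A :=
  ∑ k ∈ Finset.range (m + 1), ∑ j ∈ Finset.range (M + 1),
    -- The subtraction does not truncate where the coefficient is nonzero: for a polar family `2j ≤
    -- (n + d)k ≤ dm + nk`.
    (P k).coeff j • (h ^ (d * m + n * k - 2 * j) * (z ^ n + w ^ n) ^ (m - k) * (z * w) ^ j)

lemma map_polarForm {A B : Type*} [CommRing A] [Algebra ℂ A] [CommRing B] [Algebra ℂ B]
    (φ : A →ₐ[ℂ] B) (n d m M : ℕ) (P : ℕ → Polynomial ℂ) (h z w : A) :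
    φ (polarForm n d m M P h z w) = polarForm n d m M P (φ h) (φ z) (φ w) := by
  simp [polarForm]

/-- The conditions on the exponents of a polar form that determine its degree and its order at the
origin and at the absolute points. -/
structure IsPolarFamily (n d m M : ℕ) (P : ℕ → Polynomial ℂ) : Prop where
  two_mul_eq : 2 * M = (n + d) * m
  le_of_coeff_ne : ∀ k ≤ m, ∀ j, (P k).coeff j ≠ 0 → n * k ≤ 2 * j
  ge_of_coeff_ne : ∀ k ≤ m, ∀ j, (P k).coeff j ≠ 0 → 2 * j ≤ (n + d) * k
  zero_eq : P 0 = 1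
  lead_ne : (P m).coeff M ≠ 0

namespace IsPolarFamily

variable {n d m M : ℕ} {P : ℕ → Polynomial ℂ}

section Eval

variable {A : Type*} [CommRing A] [Algebra ℂ A]

lemma dvd_polarForm {h z w x : A} {N : ℕ}
    (H : ∀ k ≤ m, ∀ j, (P k).coeff j ≠ 0 →
      x ^ N ∣ h ^ (d * m + n * k - 2 * j) * (z ^ n + w ^ n) ^ (m - k) * (z * w) ^ j) :
    x ^ N ∣ polarForm n d m M P h z w := by
  refine Finset.dvd_sum fun k hk => Finset.dvd_sum fun j _ => ?_
  by_cases hc : (P k).coeff j = 0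
  · simp [hc]
  · rw [Algebra.smul_def]
    exact dvd_mul_of_dvd_right (H k (by simpa [Nat.lt_succ_iff] using hk) j hc) _

/-- For `k > 0` the bound `2j ≥ nk > 0` forces a factor `zw`, so only `k = j = 0` survives. -/
lemma polarForm_eq_first (hP : IsPolarFamily n d m M P) (hn : 0 < n) {h z w : A} (hzw : z * w = 0) :
    polarForm n d m M P h z w = h ^ (d * m) * (z ^ n + w ^ n) ^ m := by
  rw [polarForm, Finset.sum_eq_single_of_mem 0 (by simp),
    Finset.sum_eq_single_of_mem 0 (by simp)]
  · simp [hP.zero_eq]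
  · intro j _ hj
    simp [hzw, hj]
  · intro k hk hk0
    refine Finset.sum_eq_zero fun j _ => ?_
    by_cases hc : (P k).coeff j = 0
    · simp [hc]
    · have := hP.le_of_coeff_ne k (by simpa [Nat.lt_succ_iff] using hk) j hc
      have : 0 < n * k := Nat.mul_pos hn (by omega)
      rw [hzw, zero_pow (by omega), mul_zero, smul_zero]

/-- The exponent of `h` is at least `d(m - k)`, so it is zero only for `k = m`, and then only for
`2j = (n + d)m = 2M`. -/
lemma polarForm_eq_last (hP : IsPolarFamily n d m M P) (hd : 0 < d) (z w : A) :
    polarForm n d m M P 0 z w = (P m).coeff M • (z * w) ^ M := by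
  have h2 := hP.two_mul_eq
  rw [polarForm, Finset.sum_eq_single_of_mem m (by simp),
    Finset.sum_eq_single_of_mem M (by simp)]
  · rw [show d * m + n * m - 2 * M = 0 by rw [h2, add_mul]; omega]
    simp
  · intro j hj hjM
    have : j < M := by simp at hj; omega
    rw [zero_pow (by rw [add_mul] at h2; omega)]
    simp
  · intro k hk hkm
    refine Finset.sum_eq_zero fun j _ => ?_
    by_cases hc : (P k).coeff j = 0
    · simp [hc]
    · have hk' : k < m := by simp at hk; omega
      have := hP.ge_of_coeff_ne k hk'.le j hc
      have : d * k < d * m := Nat.mul_lt_mul_of_pos_left hk' hd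
      rw [zero_pow (by rw [add_mul] at *; omega)]
      simp

end Eval

end IsPolarFamily

/-- The affine polynomial `∑ Pₖ,ⱼ (z ^ n + w ^ n) ^ (m - k) (z w) ^ j` in the coordinates `x, y`,
where `z = x + i y` and `w = x - i y`. -/
noncomputable def polarPolynomial (n d m M : ℕ) (P : ℕ → Polynomial ℂ) : MvPolynomial (Fin 2) ℂ :=
  polarForm n d m M P 1 (X 0 + C Complex.I * X 1) (X 0 - C Complex.I * X 1)

lemma isHomogeneous_add_I_mul :
    (X 0 + C Complex.I * X 1 : MvPolynomial (Fin 2) ℂ).IsHomogeneous 1 :=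
  (isHomogeneous_X _ _).add (isHomogeneous_C_mul_X _ _)

lemma isHomogeneous_sub_I_mul :
    (X 0 - C Complex.I * X 1 : MvPolynomial (Fin 2) ℂ).IsHomogeneous 1 :=
  (isHomogeneous_X _ _).sub (isHomogeneous_C_mul_X _ _)

lemma isHomogeneous_polar_term (n m k j : ℕ) :
    (((X 0 + C Complex.I * X 1) ^ n + (X 0 - C Complex.I * X 1) ^ n) ^ (m - k) *
      ((X 0 + C Complex.I * X 1) * (X 0 - C Complex.I * X 1)) ^ j :
      MvPolynomial (Fin 2) ℂ).IsHomogeneous (n * (m - k) + 2 * j) := by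
  have h := (((isHomogeneous_add_I_mul.pow n).add (isHomogeneous_sub_I_mul.pow n)).pow (m - k)).mul
    ((isHomogeneous_add_I_mul.mul isHomogeneous_sub_I_mul).pow j)
  simpa using h

namespace IsPolarFamily

variable {n d m M : ℕ} {P : ℕ → Polynomial ℂ}

lemma term_degree_le (hP : IsPolarFamily n d m M P) {k j : ℕ} (hk : k ≤ m)
    (hc : (P k).coeff j ≠ 0) :
    n * (m - k) + 2 * j ≤ (n + d) * m ∧
      (n + d) * m - (n * (m - k) + 2 * j) = d * m + n * k - 2 * j := by
  have h2 := hP.ge_of_coeff_ne k hk j hc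
  obtain ⟨l, rfl⟩ := Nat.exists_eq_add_of_le hk
  simp only [add_tsub_cancel_left]
  constructor
  · nlinarith
  · rw [show (n + d) * (k + l) = n * l + (d * (k + l) + n * k) by ring, Nat.add_sub_add_left]

lemma totalDegree_le (hP : IsPolarFamily n d m M P) :
    (polarPolynomial n d m M P).totalDegree ≤ (n + d) * m := by
  refine totalDegree_finsetSum_le fun k hk => totalDegree_finsetSum_le fun j _ => ?_
  by_cases hc : (P k).coeff j = 0
  · simp [hc]
  · refine (totalDegree_smul_le _ _).trans ?_
    rw [one_pow, one_mul]
    exact (isHomogeneous_polar_term n m k j).totalDegree_le.trans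
      (hP.term_degree_le (by simpa [Nat.lt_succ_iff] using hk) hc).1

lemma homogenizeAt_eq (hP : IsPolarFamily n d m M P) :
    homogenizeAt ((n + d) * m) (polarPolynomial n d m M P) =
      polarForm n d m M P (X 0) (X 1 + C Complex.I * X 2) (X 1 - C Complex.I * X 2) := by
  rw [polarPolynomial, polarForm, polarForm, map_sum]
  refine Finset.sum_congr rfl fun k hk => ?_
  rw [map_sum]
  refine Finset.sum_congr rfl fun j _ => ?_
  by_cases hc : (P k).coeff j = 0
  · simp [hc]
  · have h := hP.term_degree_le (by simpa [Nat.lt_succ_iff] using hk) hc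
    rw [map_smul, one_pow, one_mul,
      homogenizeAt_of_isHomogeneous (isHomogeneous_polar_term n m k j) h.1, h.2]
    simp [mul_assoc]

/-- If the top component vanished, `X 0` would divide the homogenization. But at `(0 : 1 : 0)`,
where `z = w = 1`, its value is the leading coefficient. -/
lemma coeff_totalDegree (hP : IsPolarFamily n d m M P) (hd : 0 < d) :
    homogeneousComponent ((n + d) * m) (polarPolynomial n d m M P) ≠ 0 := by
  intro h0
  have h1 : homogenizeAt ((n + d) * m) (polarPolynomial n d m M P) =
      X 0 * ∑ k ∈ Finset.range ((n + d) * m), X 0 ^ ((n + d) * m - (k + 1)) *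
        rename Fin.succ (homogeneousComponent k (polarPolynomial n d m M P)) := by
    simp only [homogenizeAt, LinearMap.coe_sum, Finset.sum_apply, LinearMap.comp_apply,
      LinearMap.mulLeft_apply, AlgHom.toLinearMap_apply]
    rw [Finset.sum_range_succ, h0, map_zero, mul_zero, add_zero, Finset.mul_sum]
    refine Finset.sum_congr rfl fun k hk => ?_
    rw [← mul_assoc, ← pow_succ']
    congr 2
    have := Finset.mem_range.mp hk
    omega
  have h2 := congrArg (aeval (![0, 1, 0] : Fin 3 → ℂ)) h1
  rw [hP.homogenizeAt_eq, map_polarForm] at h2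
  simp only [aeval_X, map_add, map_sub, map_mul, Matrix.cons_val_zero, zero_mul] at h2
  rw [hP.polarForm_eq_last hd] at h2
  simp [hP.lead_ne] at h2

lemma totalDegree_eq (hP : IsPolarFamily n d m M P) (hd : 0 < d) :
    (polarPolynomial n d m M P).totalDegree = (n + d) * m := by
  refine hP.totalDegree_le.antisymm (not_lt.mp fun h => hP.coeff_totalDegree hd ?_)
  exact homogeneousComponent_eq_zero _ _ h

lemma homogenization_eq (hP : IsPolarFamily n d m M P) (hd : 0 < d) :
    homogenization (polarPolynomial n d m M P) =
      polarForm n d m M P (X 0) (X 1 + C Complex.I * X 2) (X 1 - C Complex.I * X 2) := by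
  rw [homogenization_eq_homogenizeAt, hP.totalDegree_eq hd, hP.homogenizeAt_eq]

/-- The restriction of the homogenized polar polynomial to a line. -/
lemma aeval_homogenization (hP : IsPolarFamily n d m M P) (hd : 0 < d) (p q : Fin 3 → ℂ) :
    aeval (fun i => Polynomial.C (p i) + Polynomial.C (q i) * Polynomial.X)
      (homogenization (polarPolynomial n d m M P)) =
    polarForm n d m M P (Polynomial.C (p 0) + Polynomial.C (q 0) * Polynomial.X)
      (Polynomial.C (p 1 + Complex.I * p 2) + Polynomial.C (q 1 + Complex.I * q 2) * Polynomial.X)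
      (Polynomial.C (p 1 - Complex.I * p 2) +
        Polynomial.C (q 1 - Complex.I * q 2) * Polynomial.X) := by
  have hI : (aeval (fun i => Polynomial.C (p i) + Polynomial.C (q i) * Polynomial.X))
      (C Complex.I : MvPolynomial (Fin 3) ℂ) = Polynomial.C Complex.I := by
    rw [aeval_C]; rfl
  rw [hP.homogenization_eq hd, map_polarForm]
  simp only [aeval_X, map_add, map_sub, map_mul, hI]
  congr 1 <;> ring

lemma isFoldPoint_origin (hP : IsPolarFamily n d m M P) (hn : 0 < n) (hd : 0 < d) :
    IsFoldPoint (n * m) (homogenization (polarPolynomial n d m M P)) originPoint := by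
  -- This direction has `z = 1`, `w = 0`, so only the term `(z^n + w^n)^m` remains. In general the
  -- terms have order at least `n(m - k) + 2j ≥ nm`.
  refine isFoldPoint_of_lines (fun q => ?_) ⟨![0, 1 / 2, -Complex.I / 2], ?_⟩
  · rw [hP.aeval_homogenization hd]
    simp only [originPoint, Matrix.cons_val_zero, Matrix.cons_val_one, Matrix.cons_val, mul_zero,
      add_zero, sub_zero, map_zero, zero_add]
    refine dvd_polarForm fun k hk j hc => ?_
    have h1 := hP.le_of_coeff_ne k hk j hc
    refine (pow_dvd_pow _ (?_ : n * m ≤ n * (m - k) + 2 * j)).trans ?_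
    · obtain ⟨l, rfl⟩ := Nat.exists_eq_add_of_le hk
      simp only [add_tsub_cancel_left]
      nlinarith
    · rw [pow_add, pow_mul, pow_mul, mul_assoc]
      refine dvd_mul_of_dvd_right (mul_dvd_mul (pow_dvd_pow_of_dvd ?_ _) (pow_dvd_pow_of_dvd ?_ _)) _
      · exact dvd_add (pow_dvd_pow_of_dvd (dvd_mul_left _ _) _)
          (pow_dvd_pow_of_dvd (dvd_mul_left _ _) _)
      · rw [sq]
        exact mul_dvd_mul (dvd_mul_left _ _) (dvd_mul_left _ _)
  · rw [hP.aeval_homogenization hd]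
    have e1 : (1 : ℂ) / 2 + Complex.I * (-Complex.I / 2) = 1 := by
      linear_combination (-1 / 2) * Complex.I_sq
    have e2 : (1 : ℂ) / 2 - Complex.I * (-Complex.I / 2) = 0 := by
      linear_combination (1 / 2) * Complex.I_sq
    simp only [originPoint, Matrix.cons_val_zero, Matrix.cons_val_one, Matrix.cons_val, mul_zero,
      add_zero, sub_zero, map_zero, zero_add, e1, e2, map_one, one_mul, zero_mul]
    rw [hP.polarForm_eq_first hn (mul_zero _)]
    simp [hn.ne', ← pow_mul]

/-- Since `2j ≤ (n + d)k`, the exponent `dm + nk - j` is at least `dm + (n - d)k/2`. Over `0 ≤ k ≤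
m` this is smallest at `k = 0` (value `dm`) if `d ≤ n` and at `k = m` (value `M`) if `n ≤ d`. -/
lemma absolute_exponent (hP : IsPolarFamily n d m M P) {k j : ℕ} (hk : k ≤ m)
    (hc : (P k).coeff j ≠ 0) :
    (d ≤ n → d * m ≤ d * m + n * k - 2 * j + j) ∧ (n ≤ d → M ≤ d * m + n * k - 2 * j + j) := by
  have h2 := hP.ge_of_coeff_ne k hk j hc
  have h3 := hP.two_mul_eq
  obtain ⟨l, rfl⟩ := Nat.exists_eq_add_of_le hk
  have h4 : 2 * j ≤ d * (k + l) + n * k := by nlinarith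
  refine ⟨fun h => ?_, fun h => ?_⟩
  · have : d * k ≤ n * k := Nat.mul_le_mul_right _ h
    have : 2 * j ≤ n * k + d * k := by nlinarith
    omega
  · have : n * l ≤ d * l := Nat.mul_le_mul_right _ h
    have e1 : (n + d) * (k + l) = n * k + d * k + n * l + d * l := by ring
    have e2 : d * (k + l) = d * k + d * l := by ring
    have e3 : (n + d) * k = n * k + d * k := by ring
    omega

lemma dvd_polarForm_absolute {N : ℕ}
    (hN : ∀ k ≤ m, ∀ j, (P k).coeff j ≠ 0 → N ≤ d * m + n * k - 2 * j + j)
    {A : Type*} [CommRing A] [Algebra ℂ A] {x h z w : A} (hh : x ∣ h) (hzw : x ∣ z * w) :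
    x ^ N ∣ polarForm n d m M P h z w := by
  refine dvd_polarForm fun k hk j hc => (pow_dvd_pow _ (hN k hk j hc)).trans ?_
  rw [pow_add]
  exact mul_dvd_mul (dvd_mul_of_dvd_left (pow_dvd_pow_of_dvd hh _) _) (pow_dvd_pow_of_dvd hzw _)

lemma isFoldPoint_absolute (hP : IsPolarFamily n d m M P) (hn : 0 < n) (hd : 0 < d) {ε : ℂ}
    (hε : ε ^ 2 = -1) :
    (d ≤ n → IsFoldPoint (d * m) (homogenization (polarPolynomial n d m M P)) ![0, 1, ε]) ∧
    (n ≤ d → IsFoldPoint M (homogenization (polarPolynomial n d m M P)) ![0, 1, ε]) := by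
  have hdvd : ∀ N, (∀ k ≤ m, ∀ j, (P k).coeff j ≠ 0 → N ≤ d * m + n * k - 2 * j + j) →
      ∀ q : Fin 3 → ℂ, Polynomial.X ^ N ∣
      aeval (fun i => Polynomial.C ((![0, 1, ε] : Fin 3 → ℂ) i) + Polynomial.C (q i) * Polynomial.X)
        (homogenization (polarPolynomial n d m M P)) := by
    intro N hN q
    rw [hP.aeval_homogenization hd]
    refine dvd_polarForm_absolute hN (by simp) ?_
    rw [Polynomial.X_dvd_iff, Polynomial.coeff_zero_eq_eval_zero]
    simp only [Matrix.cons_val_one, Matrix.cons_val_zero, Matrix.cons_val, Polynomial.eval_mul,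
      Polynomial.eval_add, Polynomial.eval_C, Polynomial.eval_X, mul_zero, add_zero]
    linear_combination (-1) * hε * Complex.I ^ 2 - Complex.I_sq * (-1)
  have hcases : ε = Complex.I ∨ ε = -Complex.I := by
    rw [← Complex.I_sq] at hε
    exact sq_eq_sq_iff_eq_or_eq_neg.mp hε
  have e1 : (1 : ℂ) + Complex.I * Complex.I = 0 := by rw [Complex.I_mul_I]; norm_num
  have e2 : (1 : ℂ) - Complex.I * Complex.I = 2 := by rw [Complex.I_mul_I]; norm_num
  have e3 : (1 : ℂ) + Complex.I * -Complex.I = 2 := by rw [mul_neg, Complex.I_mul_I]; norm_num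
  have e4 : (1 : ℂ) - Complex.I * -Complex.I = 0 := by rw [mul_neg, Complex.I_mul_I]; norm_num
  -- For `d ≤ n` the test line keeps `z` and `w` constant, one of them zero, so only the first term
  -- is left. For `n ≤ d` it is the line at infinity, where only the last term is left.
  refine ⟨fun h => isFoldPoint_of_lines
    (hdvd _ fun k hk j hc => (hP.absolute_exponent hk hc).1 h) ⟨![1, 0, 0], ?_⟩,
    fun h => isFoldPoint_of_lines
    (hdvd _ fun k hk j hc => (hP.absolute_exponent hk hc).2 h) ⟨![0, 1, -ε], ?_⟩⟩
  · have h2 : (Polynomial.X ^ (d * m) * (Polynomial.C (2 : ℂ) ^ n) ^ m).coeff (d * m) ≠ 0 := by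
      rw [← Polynomial.C_pow, ← Polynomial.C_pow, Polynomial.coeff_mul_C, Polynomial.coeff_X_pow,
        if_pos rfl]
      simp
    rw [hP.aeval_homogenization hd]
    rcases hcases with rfl | rfl
    · simp only [Matrix.cons_val_zero, Matrix.cons_val_one, Matrix.cons_val, map_zero, map_one,
        zero_add, one_mul, mul_zero, add_zero, sub_zero, zero_mul, e1, e2]
      rw [hP.polarForm_eq_first hn (zero_mul _), zero_pow hn.ne', zero_add]
      exact h2
    · simp only [Matrix.cons_val_zero, Matrix.cons_val_one, Matrix.cons_val, map_zero, map_one,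
        zero_add, one_mul, mul_zero, add_zero, sub_zero, zero_mul, e3, e4]
      rw [hP.polarForm_eq_first hn (mul_zero _), zero_pow hn.ne', add_zero]
      exact h2
  · have h2 : ((P m).coeff M •
        (Polynomial.C (2 : ℂ) * Polynomial.X * Polynomial.C 2) ^ M).coeff M ≠ 0 := by
      rw [mul_right_comm, mul_pow, ← Polynomial.C_mul, ← Polynomial.C_pow, Polynomial.coeff_smul,
        Polynomial.coeff_C_mul, Polynomial.coeff_X_pow, if_pos rfl]
      simpa using hP.lead_ne
    rw [hP.aeval_homogenization hd]
    rcases hcases with rfl | rfl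
    · simp only [Matrix.cons_val_zero, Matrix.cons_val_one, Matrix.cons_val, map_zero,
        zero_add, add_zero, zero_mul, e1, e2, e3, e4]
      rw [hP.polarForm_eq_last hd]
      exact h2
    · simp only [Matrix.cons_val_zero, Matrix.cons_val_one, Matrix.cons_val, map_zero,
        zero_add, add_zero, zero_mul, neg_neg, e1, e2, e3, e4]
      rw [hP.polarForm_eq_last hd, mul_comm]
      exact h2

end IsPolarFamily

/-! ### Pseudo-division -/

section PseudoDivision

/-- The leading coefficient of `D` need not be a unit; each step of the Euclidean algorithm
multiplies by it once instead of dividing. -/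
lemma exists_C_leadingCoeff_pow_mul_eq {R : Type*} [CommRing R] [IsDomain R] {D : Polynomial R}
    (hD : D ≠ 0) (G : Polynomial R) :
    ∃ (N : ℕ) (q r : Polynomial R),
      Polynomial.C (D.leadingCoeff ^ N) * G = D * q + r ∧ r.degree < D.degree := by
  suffices H : ∀ (k : ℕ) (G : Polynomial R), G.degree < k →
      ∃ (N : ℕ) (q r : Polynomial R),
        Polynomial.C (D.leadingCoeff ^ N) * G = D * q + r ∧ r.degree < D.degree from
    H (G.natDegree + 1) G (lt_of_le_of_lt Polynomial.degree_le_natDegree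
      (by exact_mod_cast Nat.lt_succ_self _))
  intro k
  induction k with
  | zero =>
    intro G hG
    have : G = 0 := by simpa using hG
    exact ⟨0, 0, 0, by simp [this], by simpa [bot_lt_iff_ne_bot] using hD⟩
  | succ k ih =>
    intro G hG
    by_cases hGD : G.degree < D.degree
    · exact ⟨0, 0, G, by simp, hGD⟩
    have hG0 : G ≠ 0 := by
      rintro rfl
      exact hGD (by simpa [bot_lt_iff_ne_bot] using hD)
    have hl : D.leadingCoeff ≠ 0 := Polynomial.leadingCoeff_ne_zero.mpr hD
    have hl' : G.leadingCoeff ≠ 0 := Polynomial.leadingCoeff_ne_zero.mpr hG0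
    have hnat : D.natDegree ≤ G.natDegree := Polynomial.natDegree_le_natDegree (not_lt.mp hGD)
    set e := G.natDegree - D.natDegree
    have h1 : (Polynomial.C D.leadingCoeff * G).degree = G.degree := Polynomial.degree_C_mul hl
    have h2 : (Polynomial.C G.leadingCoeff * Polynomial.X ^ e * D).degree = G.degree := by
      rw [Polynomial.degree_mul, Polynomial.degree_C_mul_X_pow _ hl',
        Polynomial.degree_eq_natDegree hD, Polynomial.degree_eq_natDegree hG0]
      exact_mod_cast Nat.sub_add_cancel hnat
    have h3 : (Polynomial.C D.leadingCoeff * G - Polynomial.C G.leadingCoeff * Polynomial.X ^ e * D).degree <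
        G.degree := by
      rw [← h1]
      refine Polynomial.degree_sub_lt_left (h1.trans h2.symm) ?_ ?_
      · exact mul_ne_zero (by simpa using hl) hG0
      · rw [Polynomial.leadingCoeff_mul, Polynomial.leadingCoeff_mul, Polynomial.leadingCoeff_mul,
          Polynomial.leadingCoeff_C, Polynomial.leadingCoeff_C, Polynomial.leadingCoeff_X_pow,
          mul_one, mul_comm]
    have hGk : G.degree ≤ k := by
      rw [← Polynomial.natDegree_lt_iff_degree_lt hG0] at hG
      exact Polynomial.natDegree_le_iff_degree_le.mp (Nat.le_of_lt_succ hG)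
    obtain ⟨N, q, r, hq, hr⟩ := ih _ (h3.trans_le hGk)
    refine ⟨N + 1, q + Polynomial.C (D.leadingCoeff ^ N * G.leadingCoeff) * Polynomial.X ^ e, r, ?_, hr⟩
    rw [pow_succ]
    simp only [Polynomial.C_mul] at hq ⊢
    linear_combination hq

end PseudoDivision

/-! ### The chart `z = vw` -/

section Chart

/-- The substitution `z = v w` in polynomials in `z = x + i y` and `w = x - i y`. -/
noncomputable def chartMap : MvPolynomial (Fin 2) ℂ →ₐ[ℂ] Polynomial (Polynomial ℂ) :=
  aeval ![Polynomial.C (Polynomial.C (1 / 2) * (Polynomial.X + 1)) * Polynomial.X,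
    Polynomial.C (Polynomial.C (-Complex.I / 2) * (Polynomial.X - 1)) * Polynomial.X]

lemma evalEval_chartMap (v w : ℂ) (g : MvPolynomial (Fin 2) ℂ) :
    (chartMap g).evalEval v w =
      aeval ![(v * w + w) / 2, -Complex.I / 2 * (v * w - w)] g := by
  rw [← Polynomial.coe_evalEvalRingHom]
  have : ((Polynomial.evalEvalRingHom v w).comp chartMap.toRingHom) =
      (aeval (R := ℂ) ![(v * w + w) / 2, -Complex.I / 2 * (v * w - w)]).toRingHom := by
    ext i
    · simp [chartMap]
    · fin_cases i
      · simp [chartMap]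
        ring
      · simp [chartMap]
        ring
  exact congrArg (fun φ => φ g) this

lemma chartMap_C (c : ℂ) : chartMap (C c) = Polynomial.C (Polynomial.C c) := by
  rw [chartMap, aeval_C]; rfl

lemma chartMap_add_I_mul :
    chartMap (X 0 + C Complex.I * X 1) = Polynomial.C Polynomial.X * Polynomial.X := by
  have h : Complex.I * (-Complex.I / 2) = 1 / 2 := by
    linear_combination (-1 / 2) * Complex.I_sq
  have h2 : (Polynomial.C (1 / 2) * (Polynomial.X + 1) +
      Polynomial.C Complex.I * (Polynomial.C (-Complex.I / 2) * (Polynomial.X - 1))) =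
      (Polynomial.X : Polynomial ℂ) := by
    rw [← mul_assoc, ← Polynomial.C_mul, h, ← mul_add, add_add_sub_cancel, ← two_mul,
      ← mul_assoc]
    rw [show (2 : Polynomial ℂ) = Polynomial.C 2 from rfl, ← Polynomial.C_mul]
    norm_num
  rw [map_add, map_mul, chartMap_C]
  simp only [chartMap, aeval_X, Matrix.cons_val_zero, Matrix.cons_val_one]
  rw [← mul_assoc, ← Polynomial.C_mul, ← add_mul, ← Polynomial.C_add, h2]

lemma chartMap_sub_I_mul : chartMap (X 0 - C Complex.I * X 1) = Polynomial.X := by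
  have h : Complex.I * (-Complex.I / 2) = 1 / 2 := by
    linear_combination (-1 / 2) * Complex.I_sq
  have h2 : (Polynomial.C (1 / 2) * (Polynomial.X + 1) -
      Polynomial.C Complex.I * (Polynomial.C (-Complex.I / 2) * (Polynomial.X - 1))) =
      (1 : Polynomial ℂ) := by
    rw [← mul_assoc, ← Polynomial.C_mul, h, ← mul_sub, add_sub_sub_cancel, one_add_one_eq_two]
    rw [show (2 : Polynomial ℂ) = Polynomial.C 2 from rfl, ← Polynomial.C_mul]
    norm_num
  rw [map_sub, map_mul, chartMap_C]
  simp only [chartMap, aeval_X, Matrix.cons_val_zero, Matrix.cons_val_one]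
  rw [← mul_assoc, ← Polynomial.C_mul, ← sub_mul, ← Polynomial.C_sub, h2]
  simp

lemma sub_I_mul_ne_zero : (X 0 - C Complex.I * X 1 : MvPolynomial (Fin 2) ℂ) ≠ 0 := by
  intro h
  simpa using congrArg (aeval (![1, 0] : Fin 2 → ℂ)) h

/-- A point with `w ≠ 0` is reached from `v = z / w`. Hence if `g` maps to zero, `w g` vanishes at
every point. -/
lemma chartMap_injective : Function.Injective chartMap := by
  rw [injective_iff_map_eq_zero]
  intro g hg
  have h0 : (X 0 - C Complex.I * X 1) * g = 0 := by
    refine MvPolynomial.funext fun p => ?_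
    rw [map_mul, map_zero]
    by_cases hw : p 0 - Complex.I * p 1 = 0
    · simp [hw]
    · have h := evalEval_chartMap ((p 0 + Complex.I * p 1) / (p 0 - Complex.I * p 1))
        (p 0 - Complex.I * p 1) g
      rw [hg, Polynomial.evalEval_zero, div_mul_cancel₀ _ hw] at h
      have hp : (![(p 0 + Complex.I * p 1 + (p 0 - Complex.I * p 1)) / 2,
          -Complex.I / 2 * (p 0 + Complex.I * p 1 - (p 0 - Complex.I * p 1))] : Fin 2 → ℂ) = p := by
        ext i
        fin_cases i
        · simp
        · simp
          linear_combination (-p 1) * Complex.I_sq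
      rw [hp] at h
      rw [show eval p g = 0 from h.symm, mul_zero]
  exact (mul_eq_zero.mp h0).resolve_left sub_I_mul_ne_zero

/-- The chart is onto up to powers of `w`: the image contains `w` and `vw`, which generate
everything once `w` is inverted. -/
lemma exists_chartMap_eq (Q : Polynomial (Polynomial ℂ)) :
    ∃ (K : ℕ) (g : MvPolynomial (Fin 2) ℂ), chartMap g = Polynomial.X ^ K * Q := by
  have hadd : ∀ Q₁ Q₂ : Polynomial (Polynomial ℂ),
      (∃ (K : ℕ) (g : MvPolynomial (Fin 2) ℂ), chartMap g = Polynomial.X ^ K * Q₁) →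
      (∃ (K : ℕ) (g : MvPolynomial (Fin 2) ℂ), chartMap g = Polynomial.X ^ K * Q₂) →
      ∃ (K : ℕ) (g : MvPolynomial (Fin 2) ℂ), chartMap g = Polynomial.X ^ K * (Q₁ + Q₂) := by
    rintro Q₁ Q₂ ⟨K₁, g₁, h₁⟩ ⟨K₂, g₂, h₂⟩
    refine ⟨K₁ + K₂, (X 0 - C Complex.I * X 1) ^ K₂ * g₁ + (X 0 - C Complex.I * X 1) ^ K₁ * g₂, ?_⟩
    rw [map_add, map_mul, map_mul, map_pow, map_pow, chartMap_sub_I_mul, h₁, h₂]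
    ring
  have hmul : ∀ Q₁ Q₂ : Polynomial (Polynomial ℂ),
      (∃ (K : ℕ) (g : MvPolynomial (Fin 2) ℂ), chartMap g = Polynomial.X ^ K * Q₁) →
      (∃ (K : ℕ) (g : MvPolynomial (Fin 2) ℂ), chartMap g = Polynomial.X ^ K * Q₂) →
      ∃ (K : ℕ) (g : MvPolynomial (Fin 2) ℂ), chartMap g = Polynomial.X ^ K * (Q₁ * Q₂) := by
    rintro Q₁ Q₂ ⟨K₁, g₁, h₁⟩ ⟨K₂, g₂, h₂⟩
    refine ⟨K₁ + K₂, g₁ * g₂, ?_⟩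
    rw [map_mul, h₁, h₂]
    ring
  have hX : ∃ (K : ℕ) (g : MvPolynomial (Fin 2) ℂ),
      chartMap g = Polynomial.X ^ K * Polynomial.X :=
    ⟨0, _, by rw [chartMap_sub_I_mul, pow_zero, one_mul]⟩
  have hCX : ∃ (K : ℕ) (g : MvPolynomial (Fin 2) ℂ),
      chartMap g = Polynomial.X ^ K * Polynomial.C Polynomial.X :=
    ⟨1, _, by rw [chartMap_add_I_mul, pow_one, mul_comm]⟩
  have hC : ∀ p : Polynomial ℂ, ∃ (K : ℕ) (g : MvPolynomial (Fin 2) ℂ),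
      chartMap g = Polynomial.X ^ K * Polynomial.C p := by
    intro p
    induction p using Polynomial.induction_on with
    | C c => exact ⟨0, C c, by rw [chartMap_C, pow_zero, one_mul]⟩
    | add p q hp hq => rw [Polynomial.C_add]; exact hadd _ _ hp hq
    | monomial j c h => rw [pow_succ, ← mul_assoc, Polynomial.C_mul]; exact hmul _ _ h hCX
  induction Q using Polynomial.induction_on with
  | C p => exact hC p
  | add p q hp hq => exact hadd _ _ hp hq
  | monomial j c h => rw [pow_succ, ← mul_assoc]; exact hmul _ _ h hX

lemma irreducible_X_add_C_mul_X {c : ℂ} (hc : c ≠ 0) :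
    Irreducible (X 0 + C c * X 1 : MvPolynomial (Fin 2) ℂ) := by
  rw [add_comm]
  refine irreducible_mul_X_add _ _ 1 (by simpa using hc) (by simp) (by simp) ?_
  exact IsUnit.isRelPrime_left ((isUnit_iff_ne_zero.mpr hc).map C)

lemma dvd_of_dvd_irreducible_pow_mul {R : Type*} [CommRing R] [IsDomain R] [DecompositionMonoid R]
    {p f g : R} (hp : Irreducible p) (hpf : ¬ p ∣ f) {N : ℕ} (h : f ∣ p ^ N * g) : f ∣ g :=
  ((hp.isRelPrime_iff_not_dvd.mpr hpf).pow_left (m := N)).symm.dvd_of_dvd_mul_left h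

end Chart

/-! ### The polar polynomial in the chart, and descent of divisibility -/

section Quotient

/-- The quotient of `chartMap (polarPolynomial n d m M P)` by `X ^ (n * m)`. -/
noncomputable def chartQuotient (n m M : ℕ) (P : ℕ → Polynomial ℂ) : Polynomial (Polynomial ℂ) :=
  ∑ k ∈ Finset.range (m + 1), ∑ j ∈ Finset.range (M + 1),
    Polynomial.C (Polynomial.C ((P k).coeff j) * (Polynomial.X ^ n + 1) ^ (m - k) *
      Polynomial.X ^ j) * Polynomial.X ^ (2 * j - n * k)

namespace IsPolarFamily

variable {n d m M : ℕ} {P : ℕ → Polynomial ℂ}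

lemma chartMap_polarPolynomial (hP : IsPolarFamily n d m M P) :
    chartMap (polarPolynomial n d m M P) = Polynomial.X ^ (n * m) * chartQuotient n m M P := by
  rw [polarPolynomial, map_polarForm, map_one, chartMap_add_I_mul, chartMap_sub_I_mul, polarForm,
    chartQuotient, Finset.mul_sum]
  refine Finset.sum_congr rfl fun k hk => ?_
  rw [Finset.mul_sum]
  refine Finset.sum_congr rfl fun j _ => ?_
  by_cases hc : (P k).coeff j = 0
  · simp [hc]
  · have hk : k ≤ m := by simpa [Nat.lt_succ_iff] using hk
    have h1 := hP.le_of_coeff_ne k hk j hc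
    obtain ⟨l, rfl⟩ := Nat.exists_eq_add_of_le hk
    obtain ⟨i, hi⟩ := Nat.exists_eq_add_of_le h1
    have e : ∀ (c : ℂ) (Q : Polynomial (Polynomial ℂ)),
        c • Q = Polynomial.C (Polynomial.C c) * Q := fun c Q => by
      rw [Algebra.smul_def]; rfl
    rw [e, hi]
    simp only [add_tsub_cancel_left, one_pow, one_mul, Polynomial.C_mul, Polynomial.C_add,
      Polynomial.C_pow, Polynomial.C_1]
    have e2 : (Polynomial.C Polynomial.X * Polynomial.X * Polynomial.X :
        Polynomial (Polynomial ℂ)) ^ j =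
        Polynomial.C Polynomial.X ^ j * Polynomial.X ^ (n * k) * Polynomial.X ^ i := by
      rw [mul_assoc, mul_pow, ← sq, ← pow_mul, hi, pow_add, mul_assoc]
    rw [e2, mul_pow (Polynomial.C (Polynomial.X : Polynomial ℂ)), ← add_one_mul, mul_pow, ← pow_mul, mul_add,
      pow_add]
    ring

lemma natDegree_chartQuotient_le (hP : IsPolarFamily n d m M P) :
    (chartQuotient n m M P).natDegree ≤ d * m := by
  refine Polynomial.natDegree_sum_le_of_forall_le _ _ fun k hk =>
    Polynomial.natDegree_sum_le_of_forall_le _ _ fun j _ => ?_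
  by_cases hc : (P k).coeff j = 0
  · simp [hc]
  · have hk : k ≤ m := by simpa [Nat.lt_succ_iff] using hk
    have h1 := hP.ge_of_coeff_ne k hk j hc
    refine (Polynomial.natDegree_C_mul_X_pow_le _ _).trans ?_
    have : d * k ≤ d * m := Nat.mul_le_mul_left _ hk
    rw [add_mul] at h1
    omega

/-- The exponent of `w` satisfies `2j - nk ≤ dk`, so `dm` occurs only for `k = m`, `j = M`. -/
lemma coeff_chartQuotient (hP : IsPolarFamily n d m M P) (hd : 0 < d) :
    (chartQuotient n m M P).coeff (d * m) =
      Polynomial.C ((P m).coeff M) * Polynomial.X ^ M := by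
  have h2 := hP.two_mul_eq
  rw [chartQuotient, Polynomial.finsetSum_coeff, Finset.sum_eq_single_of_mem m (by simp),
    Polynomial.finsetSum_coeff, Finset.sum_eq_single_of_mem M (by simp)]
  · rw [Polynomial.coeff_C_mul_X_pow, if_pos (by rw [add_mul] at h2; omega)]
    simp
  · intro j hj hjM
    have : j < M := by simp at hj; omega
    by_cases hc : (P m).coeff j = 0
    · simp [hc]
    · have h1 := hP.le_of_coeff_ne m le_rfl j hc
      rw [Polynomial.coeff_C_mul_X_pow, if_neg (by rw [add_mul] at h2; omega)]
  · intro k hk hkm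
    rw [Polynomial.finsetSum_coeff]
    refine Finset.sum_eq_zero fun j _ => ?_
    by_cases hc : (P k).coeff j = 0
    · simp [hc]
    · have hk' : k < m := by simp at hk; omega
      have h1 := hP.ge_of_coeff_ne k hk'.le j hc
      have : d * k < d * m := Nat.mul_lt_mul_of_pos_left hk' hd
      rw [Polynomial.coeff_C_mul_X_pow, if_neg (by rw [add_mul] at h1; omega)]

lemma coeff_chartQuotient_ne (hP : IsPolarFamily n d m M P) (hd : 0 < d) :
    (chartQuotient n m M P).coeff (d * m) ≠ 0 := by
  rw [hP.coeff_chartQuotient hd]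
  simpa using hP.lead_ne

lemma natDegree_chartQuotient (hP : IsPolarFamily n d m M P) (hd : 0 < d) :
    (chartQuotient n m M P).natDegree = d * m :=
  hP.natDegree_chartQuotient_le.antisymm
    (Polynomial.le_natDegree_of_ne_zero (hP.coeff_chartQuotient_ne hd))

lemma leadingCoeff_chartQuotient (hP : IsPolarFamily n d m M P) (hd : 0 < d) :
    (chartQuotient n m M P).leadingCoeff =
      Polynomial.C ((P m).coeff M) * Polynomial.X ^ M := by
  rw [Polynomial.leadingCoeff, hP.natDegree_chartQuotient hd, hP.coeff_chartQuotient hd]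

lemma chartQuotient_ne_zero (hP : IsPolarFamily n d m M P) (hd : 0 < d) :
    chartQuotient n m M P ≠ 0 := fun h =>
  hP.coeff_chartQuotient_ne hd (by rw [h, Polynomial.coeff_zero])

/-- A polynomial whose image under the chart map is a multiple of `chartQuotient`, up to a power of
the leading coefficient of the latter, is a multiple of the polar polynomial. -/
lemma polarPolynomial_dvd (hP : IsPolarFamily n d m M P) (hn : 0 < n) (hd : 0 < d)
    {g : MvPolynomial (Fin 2) ℂ} {N : ℕ} {q : Polynomial (Polynomial ℂ)}
    (h : Polynomial.C ((chartQuotient n m M P).leadingCoeff ^ N) * chartMap g =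
      chartQuotient n m M P * q) : polarPolynomial n d m M P ∣ g := by
  obtain ⟨K, g', hg'⟩ := exists_chartMap_eq q
  have hI : -Complex.I ≠ 0 := neg_ne_zero.mpr Complex.I_ne_zero
  have hsub : (X 0 - C Complex.I * X 1 : MvPolynomial (Fin 2) ℂ) =
      X 0 + C (-Complex.I) * X 1 := by rw [C_neg]; ring
  -- The leading coefficient contributes `v^(MN)`; multiplying by `w^(MN)` turns it into `z^(MN)`, a
  -- polynomial in `x` and `y`.
  have key : polarPolynomial n d m M P ∣ (X 0 + C Complex.I * X 1) ^ (M * N) *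
      ((X 0 - C Complex.I * X 1) ^ (n * m + K) * (C ((P m).coeff M ^ N) * g)) := by
    refine ⟨(X 0 - C Complex.I * X 1) ^ (M * N) * g', chartMap_injective ?_⟩
    simp only [map_mul, map_pow, chartMap_add_I_mul, chartMap_sub_I_mul, chartMap_C, hg',
      hP.chartMap_polarPolynomial]
    rw [hP.leadingCoeff_chartQuotient hd] at h
    simp only [mul_pow, Polynomial.C_mul, Polynomial.C_pow, ← pow_mul] at h
    rw [mul_pow, pow_add]
    linear_combination Polynomial.X ^ (M * N) * Polynomial.X ^ (n * m) * Polynomial.X ^ K * h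
  -- On `zw = 0` the polar polynomial is `(z^n + w^n)^m`. It is nonzero at a point of each of the
  -- lines `z = 0` and `w = 0`, so neither `z` nor `w` divides it.
  have hval : ∀ x : Fin 2 → ℂ, (x 0 + Complex.I * x 1) * (x 0 - Complex.I * x 1) = 0 →
      (x 0 + Complex.I * x 1) ^ n + (x 0 - Complex.I * x 1) ^ n ≠ 0 →
      aeval x (polarPolynomial n d m M P) ≠ 0 := by
    intro x hx hx'
    rw [polarPolynomial, map_polarForm]
    simp only [map_add, map_sub, map_mul, aeval_X, aeval_C, Algebra.algebraMap_self, RingHom.id_apply]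
    rw [hP.polarForm_eq_first hn hx]
    simpa using fun h => absurd h hx'
  have e1 : (1 : ℂ) + Complex.I * Complex.I = 0 := by rw [Complex.I_mul_I]; norm_num
  have e2 : (1 : ℂ) - Complex.I * Complex.I = 2 := by rw [Complex.I_mul_I]; norm_num
  have e3 : (1 : ℂ) + Complex.I * -Complex.I = 2 := by rw [mul_neg, Complex.I_mul_I]; norm_num
  have e4 : (1 : ℂ) - Complex.I * -Complex.I = 0 := by rw [mul_neg, Complex.I_mul_I]; norm_num
  have h1 := dvd_of_dvd_irreducible_pow_mul (irreducible_X_add_C_mul_X Complex.I_ne_zero) ?_ key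
  · have h2 := dvd_of_dvd_irreducible_pow_mul (p := X 0 - C Complex.I * X 1)
      (hsub ▸ irreducible_X_add_C_mul_X hI) ?_ h1
    · exact (((isUnit_iff_ne_zero.mpr (pow_ne_zero N hP.lead_ne)).map C).dvd_mul_left).mp h2
    · intro hdvd
      have := map_dvd (aeval (![1, -Complex.I] : Fin 2 → ℂ)) hdvd
      refine hval ![1, -Complex.I] ?_ ?_ (by simpa [e4] using this)
      · simp [-mul_neg, e4]
      · simp [-mul_neg, e3, e4, hn.ne']
  · intro hdvd
    have := map_dvd (aeval (![1, Complex.I] : Fin 2 → ℂ)) hdvd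
    refine hval ![1, Complex.I] ?_ ?_ (by simpa [e1] using this)
    · simp [e1, -Complex.I_mul_I]
    · simp [e1, e2, hn.ne', -Complex.I_mul_I]

end IsPolarFamily

end Quotient

/-! ### Rational parametrization by the unit circle -/

section Parametrization

/-- The radius `cos (n θ) + a` as a Laurent polynomial in `t = exp (i θ)`. -/
noncomputable def polarRadius (n : ℕ) (a : ℝ) (t : ℂ) : ℂ := (t ^ n + t⁻¹ ^ n) / 2 + a

lemma ofReal_image_cyclicHarmonicCurve {n d : ℕ} (hd : 0 < d) (a : ℝ) :
    (fun (p : Fin 2 → ℝ) (i : Fin 2) => (p i : ℂ)) '' cyclicHarmonicCurve n d a =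
      {p | ∃ t : ℂ, ‖t‖ = 1 ∧
        p = ![polarRadius n a t * ((t ^ d + t⁻¹ ^ d) / 2),
          polarRadius n a t * (-Complex.I / 2 * (t ^ d - t⁻¹ ^ d))]} := by
  have hd' : (d : ℝ) ≠ 0 := by exact_mod_cast hd.ne'
  have hpow : ∀ (θ : ℝ) (k : ℕ), Complex.exp (θ * Complex.I) ^ k =
      Complex.exp ((k * θ : ℝ) * Complex.I) := fun θ k => by
    rw [← Complex.exp_nat_mul]; push_cast; ring_nf
  have hinv : ∀ (θ : ℝ) (k : ℕ), (Complex.exp (θ * Complex.I))⁻¹ ^ k =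
      Complex.exp (-(k * θ : ℝ) * Complex.I) := fun θ k => by
    rw [← Complex.exp_neg, ← Complex.exp_nat_mul]; push_cast; ring_nf
  have hcos : ∀ (θ : ℝ) (k : ℕ), (Complex.exp (θ * Complex.I) ^ k +
      (Complex.exp (θ * Complex.I))⁻¹ ^ k) / 2 = Complex.cos (k * θ : ℝ) := fun θ k => by
    rw [hpow, hinv, Complex.cos]
  have hsin : ∀ (θ : ℝ) (k : ℕ), -Complex.I / 2 * (Complex.exp (θ * Complex.I) ^ k -
      (Complex.exp (θ * Complex.I))⁻¹ ^ k) = Complex.sin (k * θ : ℝ) := fun θ k => by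
    rw [hpow, hinv, Complex.sin]; ring
  have hpt : ∀ θ : ℝ, (fun i => (((![(Real.cos ((n : ℝ) / d * (d * θ)) + a) * Real.cos (d * θ),
      (Real.cos ((n : ℝ) / d * (d * θ)) + a) * Real.sin (d * θ)] : Fin 2 → ℝ) i : ℝ) : ℂ)) =
      ![polarRadius n a (Complex.exp (θ * Complex.I)) * ((Complex.exp (θ * Complex.I) ^ d +
        (Complex.exp (θ * Complex.I))⁻¹ ^ d) / 2),
        polarRadius n a (Complex.exp (θ * Complex.I)) * (-Complex.I / 2 *
          (Complex.exp (θ * Complex.I) ^ d - (Complex.exp (θ * Complex.I))⁻¹ ^ d))] := by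
    intro θ
    rw [polarRadius, hcos, hcos, hsin, ← mul_assoc, div_mul_cancel₀ _ hd']
    ext i
    fin_cases i <;> simp
  ext p
  constructor
  · rintro ⟨_, ⟨φ, -, rfl⟩, rfl⟩
    refine ⟨Complex.exp ((φ / d : ℝ) * Complex.I), Complex.norm_exp_ofReal_mul_I _, ?_⟩
    rw [← hpt]
    simp only [mul_div_cancel₀ φ hd']
  · rintro ⟨t, ht, rfl⟩
    -- The argument is moved into `[0, 2π)`, so that `φ = dθ` falls in the prescribed interval.
    obtain ⟨θ, ⟨h0, h1⟩, rfl⟩ : ∃ θ ∈ Set.Icc (0 : ℝ) (2 * Real.pi),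
        Complex.exp (θ * Complex.I) = t := by
      refine ⟨toIcoMod Real.two_pi_pos 0 t.arg, ?_, ?_⟩
      · have := toIcoMod_mem_Ico Real.two_pi_pos 0 t.arg
        rw [zero_add] at this
        exact ⟨this.1, this.2.le⟩
      · have h := Complex.norm_mul_exp_arg_mul_I t
        rw [ht, Complex.ofReal_one, one_mul] at h
        conv_rhs => rw [← h]
        rw [← self_sub_toIcoDiv_zsmul]
        push_cast
        rw [sub_mul, Complex.exp_sub]
        have : Complex.exp (((toIcoDiv Real.two_pi_pos 0 t.arg • (2 * Real.pi) : ℝ) : ℂ) *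
            Complex.I) = 1 := by
          rw [Complex.exp_eq_one_iff]
          exact ⟨toIcoDiv Real.two_pi_pos 0 t.arg, by push_cast; simp; ring⟩
        push_cast at this
        rw [this, div_one]
    refine ⟨_, ⟨d * θ, ⟨by positivity, ?_⟩, rfl⟩, hpt θ⟩
    have : (d : ℝ) * θ ≤ d * (2 * Real.pi) := by gcongr
    linarith

open Polynomial Chebyshev in
lemma T_eval_half_add_inv {t : ℂ} (ht : ‖t‖ = 1) (n d : ℕ) :
    (T ℂ d).eval ((t ^ n + t⁻¹ ^ n) / 2) = (t ^ (n * d) + t⁻¹ ^ (n * d)) / 2 := by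
  have h := Complex.norm_mul_exp_arg_mul_I t
  rw [ht, Complex.ofReal_one, one_mul] at h
  have hcos : ∀ k : ℕ, (t ^ k + t⁻¹ ^ k) / 2 = Complex.cos (k * t.arg) := fun k => by
    rw [← h, Complex.cos, ← Complex.exp_neg, ← Complex.exp_nat_mul, ← Complex.exp_nat_mul, h]
    ring_nf
  rw [hcos, hcos, T_complex_cos]
  congr 1
  push_cast
  ring

lemma pow_add_pow_curve {n d : ℕ} {a : ℝ} {t : ℂ} (ht : ‖t‖ = 1) :
    (polarRadius n a t * t ^ d) ^ n + (polarRadius n a t * t⁻¹ ^ d) ^ n =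
      2 * polarRadius n a t ^ n *
        (Polynomial.Chebyshev.T ℂ d).eval (polarRadius n a t - a) := by
  have : polarRadius n a t - a = (t ^ n + t⁻¹ ^ n) / 2 := by rw [polarRadius]; ring
  rw [this, T_eval_half_add_inv ht, mul_pow, mul_pow, ← pow_mul, ← pow_mul, mul_comm d n]
  ring

lemma mul_curve {n d : ℕ} {a : ℝ} {t : ℂ} (ht : ‖t‖ = 1) :
    (polarRadius n a t * t ^ d) * (polarRadius n a t * t⁻¹ ^ d) = polarRadius n a t ^ 2 := by
  have h0 : t ≠ 0 := by rintro rfl; simp at ht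
  have : t ^ d * t⁻¹ ^ d = 1 := by rw [← mul_pow, mul_inv_cancel₀ h0, one_pow]
  linear_combination polarRadius n a t ^ 2 * this

end Parametrization

/-! ### Distinct roots over a generic `v` -/

section Separation

/-- The condition on the multiples of an angle by `2π / (dm)` under which the polar form of
weight `m` separates generic points of the parameter circle. -/
def SeparatesRoots (n d m : ℕ) (a : ℝ) : Prop :=
  ∀ η : ℂ, η ^ (d * m) = 1 → η ^ (n + d) = 1 → η ^ d = η ^ n → (a = 0 ∨ η ^ d = 1) → η = 1

/-- The numerator of `polarRadius n a (ζ t) * (ζ t)⁻¹ ^ d` as a polynomial in `t`, up to powers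
of `t`. -/
noncomputable def radiusNumerator (n d : ℕ) (a : ℝ) (ζ : ℂ) : Polynomial ℂ :=
  Polynomial.C (ζ⁻¹ ^ d * ζ ^ n) * Polynomial.X ^ (2 * n) +
    Polynomial.C (2 * a * ζ⁻¹ ^ d) * Polynomial.X ^ n + Polynomial.C (ζ⁻¹ ^ d * ζ⁻¹ ^ n)

lemma eval_radiusNumerator {n d : ℕ} {a : ℝ} {ζ t : ℂ} (ht : t ≠ 0) :
    (radiusNumerator n d a ζ).eval t =
      2 * t ^ n * t ^ d * (polarRadius n a (ζ * t) * (ζ * t)⁻¹ ^ d) := by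
  have hn : t ^ n * t⁻¹ ^ n = 1 := by rw [← mul_pow, mul_inv_cancel₀ ht, one_pow]
  have hd : t ^ d * t⁻¹ ^ d = 1 := by rw [← mul_pow, mul_inv_cancel₀ ht, one_pow]
  simp only [radiusNumerator, polarRadius, Polynomial.eval_add, Polynomial.eval_mul,
    Polynomial.eval_C, Polynomial.eval_pow, Polynomial.eval_X, mul_inv, mul_pow]
  rw [show ∀ A B C D E F G H : ℂ, 2 * A * B * (((C * A + D * E) / 2 + F) * (G * H)) =
    (B * H) * (C * A ^ 2 * G + D * G * (A * E) + 2 * F * A * G) from fun A B C D E F G H => by ring,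
    hn, hd]
  ring

lemma coeff_radiusNumerator {n d : ℕ} (hn : 0 < n) (a : ℝ) (ζ : ℂ) :
    (radiusNumerator n d a ζ).coeff (2 * n) = ζ⁻¹ ^ d * ζ ^ n ∧
    (radiusNumerator n d a ζ).coeff n = 2 * a * ζ⁻¹ ^ d ∧
    (radiusNumerator n d a ζ).coeff 0 = ζ⁻¹ ^ d * ζ⁻¹ ^ n := by
  simp only [radiusNumerator, Polynomial.coeff_add, Polynomial.coeff_C_mul_X_pow,
    Polynomial.coeff_C]
  refine ⟨?_, ?_, ?_⟩
  · rw [if_pos trivial, if_neg (by omega), if_neg (by omega)]; ring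
  · rw [if_neg (by omega), if_pos trivial, if_neg (by omega)]; ring
  · rw [if_neg (by omega), if_neg (by omega), if_pos trivial]; ring

lemma radiusNumerator_ne_zero {n d : ℕ} (hn : 0 < n) (a : ℝ) {ζ : ℂ} (hζ : ζ ≠ 0) :
    radiusNumerator n d a ζ ≠ 0 := by
  intro h
  have := (coeff_radiusNumerator (d := d) hn a ζ).2.2
  rw [h, Polynomial.coeff_zero] at this
  simp [hζ] at this

/-- Comparing the coefficients of degree `0`, `2n` and `n` yields, for `η = ζ / ξ`, exactly the last
three conditions in `SeparatesRoots`. -/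
lemma SeparatesRoots.radiusNumerator_injOn {n d m : ℕ} {a : ℝ} (hs : SeparatesRoots n d m a)
    (hn : 0 < n) {ζ ξ : ℂ} (hζ0 : ζ ≠ 0) (hξ0 : ξ ≠ 0) (hζ : ζ ^ (d * m) = 1)
    (hξ : ξ ^ (d * m) = 1) (h : radiusNumerator n d a ζ = radiusNumerator n d a ξ) : ζ = ξ := by
  obtain ⟨h1, h2, h3⟩ := coeff_radiusNumerator (d := d) hn a ζ
  obtain ⟨k1, k2, k3⟩ := coeff_radiusNumerator (d := d) hn a ξ
  rw [h] at h1 h2 h3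
  rw [h1] at k1
  rw [h2] at k2
  rw [h3] at k3
  have hdn : ∀ x : ℂ, x ≠ 0 → ∀ k, x ^ k ≠ 0 := fun x hx k => pow_ne_zero k hx
  have hA : ζ ^ (n + d) = ξ ^ (n + d) := by
    have := hdn _ hζ0; have := hdn _ hξ0
    rw [inv_pow, inv_pow, inv_pow, inv_pow] at k3
    rw [pow_add, pow_add]
    field_simp at k3
    linear_combination -k3
  have hB : ζ ^ n * ξ ^ d = ξ ^ n * ζ ^ d := by
    have := hdn _ hζ0; have := hdn _ hξ0
    rw [inv_pow, inv_pow] at k1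
    field_simp at k1
    linear_combination k1
  have hC : a = 0 ∨ ζ ^ d = ξ ^ d := by
    have := hdn _ hζ0; have := hdn _ hξ0
    by_cases ha : a = 0
    · exact Or.inl ha
    · right
      have ha' : (2 * a : ℂ) ≠ 0 := mul_ne_zero two_ne_zero (by exact_mod_cast ha)
      have := mul_left_cancel₀ ha' k2
      rw [inv_pow, inv_pow] at this
      exact inv_injective this
  have := hs (ζ / ξ) (by rw [div_pow, hζ, hξ, div_one])
    (by rw [div_pow, hA, div_self (hdn _ hξ0 _)])
    (by rw [div_pow, div_pow, div_eq_div_iff (hdn _ hξ0 _) (hdn _ hξ0 _)]; linear_combination -hB)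
    (hC.imp id fun h => by rw [div_pow, h, div_self (hdn _ hξ0 _)])
  exact (div_eq_one_iff_eq hξ0).mp this

lemma eventually_eval_ne_zero {p : Polynomial ℂ} (hp : p ≠ 0) :
    ∀ᶠ t in Filter.cofinite, p.eval t ≠ 0 := by
  rw [Filter.eventually_cofinite]
  simpa [Polynomial.IsRoot] using Polynomial.finite_setOfPred_isRoot hp

/-- For all but finitely many parameters `t`, the conjugate parameters `ζ t` give different nonzero
values of `polarRadius n a t * t⁻¹ ^ d`. -/
lemma SeparatesRoots.eventually_injOn {n d m : ℕ} {a : ℝ} (hs : SeparatesRoots n d m a)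
    (hn : 0 < n) (hdm : 0 < d * m) :
    ∀ᶠ t : ℂ in Filter.cofinite,
      (∀ ζ ∈ Polynomial.nthRootsFinset (d * m) (1 : ℂ),
        polarRadius n a (ζ * t) * (ζ * t)⁻¹ ^ d ≠ 0) ∧
      Set.InjOn (fun ζ => polarRadius n a (ζ * t) * (ζ * t)⁻¹ ^ d)
        (Polynomial.nthRootsFinset (d * m) (1 : ℂ)) := by
  set μ := Polynomial.nthRootsFinset (d * m) (1 : ℂ)
  have hμ : ∀ ζ ∈ μ, ζ ^ (d * m) = 1 ∧ ζ ≠ 0 := by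
    intro ζ hζ
    have := (Polynomial.mem_nthRootsFinset hdm _).mp hζ
    refine ⟨this, ?_⟩
    rintro rfl
    rw [zero_pow hdm.ne'] at this
    exact zero_ne_one this
  have h0 : ∀ᶠ t : ℂ in Filter.cofinite, t ≠ 0 := by
    simp
  have h1 : ∀ᶠ t : ℂ in Filter.cofinite, ∀ ζ ∈ μ, (radiusNumerator n d a ζ).eval t ≠ 0 :=
    (Filter.eventually_all_finset μ).mpr fun ζ hζ =>
      eventually_eval_ne_zero (radiusNumerator_ne_zero hn a (hμ ζ hζ).2)
  have h2 : ∀ᶠ t : ℂ in Filter.cofinite, ∀ ζ ∈ μ, ∀ ξ ∈ μ, ζ ≠ ξ →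
      (radiusNumerator n d a ζ - radiusNumerator n d a ξ).eval t ≠ 0 := by
    refine (Filter.eventually_all_finset μ).mpr fun ζ hζ =>
      (Filter.eventually_all_finset μ).mpr fun ξ hξ => ?_
    by_cases h : ζ = ξ
    · simp [h]
    · filter_upwards [eventually_eval_ne_zero (sub_ne_zero.mpr fun he => h
        (hs.radiusNumerator_injOn hn (hμ ζ hζ).2 (hμ ξ hξ).2 (hμ ζ hζ).1 (hμ ξ hξ).1 he))]
        with t ht _ using ht
  filter_upwards [h0, h1, h2] with t ht0 ht1 ht2
  refine ⟨fun ζ hζ h => ht1 ζ hζ ?_, fun ζ hζ ξ hξ h => ?_⟩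
  · rw [eval_radiusNumerator ht0, h, mul_zero]
  · by_contra hne
    refine ht2 ζ hζ ξ hξ hne ?_
    rw [Polynomial.eval_sub, eval_radiusNumerator ht0, eval_radiusNumerator ht0]
    simp only at h
    rw [h, sub_self]

/-- A bivariate polynomial of small degree in the second variable that has many roots over
infinitely many `t ^ e` vanishes. -/
lemma eq_zero_of_frequently_card {r : Polynomial (Polynomial ℂ)} {e N : ℕ} (he : 0 < e)
    (hr : r.degree < N)
    (h : ∃ᶠ t : ℂ in Filter.cofinite, ∃ s : Finset ℂ, N ≤ s.card ∧
      ∀ w ∈ s, r.evalEval (t ^ e) w = 0) : r = 0 := by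
  ext1 k
  rw [Polynomial.coeff_zero]
  by_contra hk
  -- Substituting `t^e` for `v` keeps the coefficient nonzero, so it vanishes for only finitely many
  -- `t`.
  have hk' : Polynomial.expand ℂ e (r.coeff k) ≠ 0 := (Polynomial.expand_ne_zero he).mpr hk
  obtain ⟨t, ⟨s, hs, hroot⟩, ht⟩ := (h.and_eventually (eventually_eval_ne_zero hk')).exists
  have hz : r.map (Polynomial.evalRingHom (t ^ e)) = 0 := by
    refine Polynomial.eq_zero_of_degree_lt_of_eval_finset_eq_zero s ?_ ?_
    · exact (Polynomial.degree_map_le).trans_lt (hr.trans_le (by exact_mod_cast hs))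
    · intro w hw
      rw [Polynomial.map_evalRingHom_eval]
      exact hroot w hw
  apply ht
  rw [Polynomial.expand_eval]
  simpa using congrArg (fun p => p.coeff k) hz

end Separation

/-! ### The polar polynomial generates the vanishing ideal -/

section CurveEquation

variable {n d m M : ℕ} {a : ℝ} {P : ℕ → Polynomial ℂ}

lemma IsPolarFamily.dvd_of_mem_vanishingIdeal (hP : IsPolarFamily n d m M P)
    (hs : SeparatesRoots n d m a) (hn : 0 < n) (hd : 0 < d) (hm : m ∣ 2)
    (h0 : polarPolynomial n d m M P ∈ vanishingIdeal ℂ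
      ((fun (p : Fin 2 → ℝ) (i : Fin 2) => (p i : ℂ)) '' cyclicHarmonicCurve n d a))
    {g : MvPolynomial (Fin 2) ℂ}
    (hg : g ∈ vanishingIdeal ℂ
      ((fun (p : Fin 2 → ℝ) (i : Fin 2) => (p i : ℂ)) '' cyclicHarmonicCurve n d a)) :
    polarPolynomial n d m M P ∣ g := by
  have hdm : 0 < d * m := Nat.mul_pos hd (Nat.pos_of_dvd_of_pos hm two_pos)
  obtain ⟨N, q, r, hqr, hr⟩ :=
    exists_C_leadingCoeff_pow_mul_eq (hP.chartQuotient_ne_zero hd) (chartMap g)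
  suffices r = 0 from hP.polarPolynomial_dvd hn hd (by rw [hqr, this, add_zero])
  have hdeg : (chartQuotient n m M P).degree = (d * m : ℕ) := by
    rw [Polynomial.degree_eq_natDegree (hP.chartQuotient_ne_zero hd), hP.natDegree_chartQuotient hd]
  rw [hdeg] at hr
  have hvan : ∀ t : ℂ, ‖t‖ = 1 → ∀ ζ ∈ Polynomial.nthRootsFinset (d * m) (1 : ℂ),
      ∀ f ∈ vanishingIdeal ℂ
        ((fun (p : Fin 2 → ℝ) (i : Fin 2) => (p i : ℂ)) '' cyclicHarmonicCurve n d a),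
      (chartMap f).evalEval (t ^ (2 * d)) (polarRadius n a (ζ * t) * (ζ * t)⁻¹ ^ d) = 0 := by
    intro t ht ζ hζ f hf
    have hζ1 : ζ ^ (d * m) = 1 := (Polynomial.mem_nthRootsFinset hdm _).mp hζ
    have hζt : ‖ζ * t‖ = 1 := by
      rw [norm_mul, ht, mul_one]
      exact Complex.norm_eq_one_of_pow_eq_one hζ1 hdm.ne'
    have hne : ζ * t ≠ 0 := by
      intro h
      rw [h, norm_zero] at hζt
      exact zero_ne_one hζt
    -- Here `m ∣ 2` is needed: `ζ^(dm) = 1` then implies `ζ^(2d) = 1`, so all conjugate parameters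
    -- lie over the same `v`.
    have hv : t ^ (2 * d) = (ζ * t) ^ (2 * d) := by
      obtain ⟨l, hl⟩ := hm
      have : ζ ^ (2 * d) = 1 := by
        rw [hl, show m * l * d = d * m * l by ring, pow_mul, hζ1, one_pow]
      rw [mul_pow, this, one_mul]
    have hz : t ^ (2 * d) * (polarRadius n a (ζ * t) * (ζ * t)⁻¹ ^ d) =
        polarRadius n a (ζ * t) * (ζ * t) ^ d := by
      rw [hv]
      generalize ζ * t = τ at hne
      have : τ ^ d * τ⁻¹ ^ d = 1 := by rw [← mul_pow, mul_inv_cancel₀ hne, one_pow]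
      rw [two_mul, pow_add]
      linear_combination polarRadius n a τ * τ ^ d * this
    rw [evalEval_chartMap, hz]
    refine (mem_vanishingIdeal_iff.mp hf) _ ?_
    rw [ofReal_image_cyclicHarmonicCurve hd]
    refine ⟨ζ * t, hζt, ?_⟩
    congr 1
    · ring
    · congr 1
      ring
  refine eq_zero_of_frequently_card (e := 2 * d) (by omega) hr ?_
  have hinf : ∃ᶠ t : ℂ in Filter.cofinite, ‖t‖ = 1 := by
    rw [Filter.frequently_cofinite_iff_infinite]
    refine Set.Infinite.of_image Complex.arg (Set.Infinite.mono (fun θ hθ => ?_)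
      (Set.Ioo_infinite (neg_lt_self Real.pi_pos)))
    exact ⟨Complex.exp (θ * Complex.I), Complex.norm_exp_ofReal_mul_I θ, by
      rw [Complex.arg_exp_mul_I, toIocMod_eq_self]
      exact ⟨hθ.1, by linarith [hθ.2]⟩⟩
  refine (hinf.and_eventually (hs.eventually_injOn hn hdm)).mono ?_
  rintro t ⟨ht, hne, hinj⟩
  refine ⟨(Polynomial.nthRootsFinset (d * m) (1 : ℂ)).image
    (fun ζ => polarRadius n a (ζ * t) * (ζ * t)⁻¹ ^ d), ?_, ?_⟩
  · rw [Finset.card_image_of_injOn hinj,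
      (Complex.isPrimitiveRoot_exp _ hdm.ne').card_nthRootsFinset]
  · intro w hw
    obtain ⟨ζ, hζ, rfl⟩ := Finset.mem_image.mp hw
    -- As `w ≠ 0`, the factor `w^(nm)` can be cancelled: `w` is a root of `Q`, hence of the
    -- remainder.
    have h1 := hvan t ht ζ hζ _ h0
    rw [hP.chartMap_polarPolynomial, Polynomial.evalEval_mul, Polynomial.evalEval_pow,
      Polynomial.evalEval_X] at h1
    have h2 := (mul_eq_zero.mp h1).resolve_left (pow_ne_zero _ (hne ζ hζ))
    have h3 := congrArg (fun p => p.evalEval (t ^ (2 * d))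
      (polarRadius n a (ζ * t) * (ζ * t)⁻¹ ^ d)) hqr
    simp only [Polynomial.evalEval_mul, Polynomial.evalEval_add, h2, hvan t ht ζ hζ _ hg, mul_zero,
      zero_mul, zero_add] at h3
    exact h3.symm

lemma IsPolarFamily.polarForm_one_eq (hP : IsPolarFamily n d m M P) (z w : ℂ) :
    polarForm n d m M P 1 z w =
      ∑ k ∈ Finset.range (m + 1), (z ^ n + w ^ n) ^ (m - k) * (P k).eval (z * w) := by
  refine Finset.sum_congr rfl fun k hk => ?_
  have hk : k ≤ m := by simpa [Nat.lt_succ_iff] using hk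
  have hdeg : (P k).natDegree < M + 1 := by
    by_cases h : P k = 0
    · simp [h]
    · have h1 := hP.ge_of_coeff_ne k hk _ (by simpa using h : (P k).coeff (P k).natDegree ≠ 0)
      have h2 := hP.two_mul_eq
      have h3 := Nat.mul_le_mul_left (n + d) hk
      omega
  rw [Polynomial.eval_eq_sum_range' hdeg, Finset.mul_sum]
  refine Finset.sum_congr rfl fun j _ => ?_
  rw [smul_eq_mul, one_pow]
  ring

lemma IsPolarFamily.mem_vanishingIdeal (hP : IsPolarFamily n d m M P) (hd : 0 < d)
    (hvan : ∀ ρ : ℂ, ∑ k ∈ Finset.range (m + 1),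
      (2 * ρ ^ n * (Polynomial.Chebyshev.T ℂ d).eval (ρ - a)) ^ (m - k) * (P k).eval (ρ ^ 2) = 0) :
    polarPolynomial n d m M P ∈ vanishingIdeal ℂ
      ((fun (p : Fin 2 → ℝ) (i : Fin 2) => (p i : ℂ)) '' cyclicHarmonicCurve n d a) := by
  rw [mem_vanishingIdeal_iff, ofReal_image_cyclicHarmonicCurve hd]
  rintro _ ⟨t, ht, rfl⟩
  rw [polarPolynomial, map_polarForm]
  simp only [map_one, map_add, map_sub, map_mul, aeval_X, aeval_C, Algebra.algebraMap_self,
    RingHom.id_apply, Matrix.cons_val_zero, Matrix.cons_val_one]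
  have hz : polarRadius n a t * ((t ^ d + t⁻¹ ^ d) / 2) + Complex.I *
      (polarRadius n a t * (-Complex.I / 2 * (t ^ d - t⁻¹ ^ d))) = polarRadius n a t * t ^ d := by
    linear_combination (-1 / 2) * polarRadius n a t * (t ^ d - t⁻¹ ^ d) * Complex.I_sq
  have hw : polarRadius n a t * ((t ^ d + t⁻¹ ^ d) / 2) - Complex.I *
      (polarRadius n a t * (-Complex.I / 2 * (t ^ d - t⁻¹ ^ d))) = polarRadius n a t * t⁻¹ ^ d := by
    linear_combination (1 / 2) * polarRadius n a t * (t ^ d - t⁻¹ ^ d) * Complex.I_sq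
  rw [hz, hw, hP.polarForm_one_eq, pow_add_pow_curve ht, mul_curve ht]
  exact hvan _

lemma IsPolarFamily.isCurveEquation (hP : IsPolarFamily n d m M P)
    (hs : SeparatesRoots n d m a) (hn : 0 < n) (hd : 0 < d) (hm : m ∣ 2)
    (hvan : ∀ ρ : ℂ, ∑ k ∈ Finset.range (m + 1),
      (2 * ρ ^ n * (Polynomial.Chebyshev.T ℂ d).eval (ρ - a)) ^ (m - k) * (P k).eval (ρ ^ 2) = 0) :
    IsCurveEquation (cyclicHarmonicCurve n d a) (polarPolynomial n d m M P) := by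
  have h0 := hP.mem_vanishingIdeal hd hvan
  refine le_antisymm (fun g hg => Ideal.mem_span_singleton.mpr
    (hP.dvd_of_mem_vanishingIdeal hs hn hd hm h0 hg)) ?_
  rwa [Ideal.span_singleton_le_iff_mem]

/-- Generators of a principal ideal differ by a unit, here a nonzero constant; results for one
equation thus pass to all. -/
lemma IsCurveEquation.exists_eq_C_mul {S : Set (Fin 2 → ℝ)} {f g : MvPolynomial (Fin 2) ℂ}
    (hf : IsCurveEquation S f) (hg : IsCurveEquation S g) :
    ∃ c : ℂ, c ≠ 0 ∧ g = C c * f := by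
  obtain ⟨u, rfl⟩ := Ideal.span_singleton_eq_span_singleton.mp (hf.symm.trans hg)
  obtain ⟨c, hc, hu⟩ := (isUnit_iff_eq_C_of_isReduced (P := (u : MvPolynomial (Fin 2) ℂ))).mp
    u.isUnit
  exact ⟨c, hc.ne_zero, by rw [hu, mul_comm]⟩

/-- Degree and multiplicities of any equation of a curve that has a polar equation. -/
lemma IsPolarFamily.of_isCurveEquation (hP : IsPolarFamily n d m M P) {S : Set (Fin 2 → ℝ)}
    (hS : IsCurveEquation S (polarPolynomial n d m M P)) (hn : 0 < n) (hd : 0 < d)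
    {f : MvPolynomial (Fin 2) ℂ} (hf : IsCurveEquation S f) :
    f.totalDegree = (n + d) * m ∧ IsFoldPoint (n * m) (homogenization f) originPoint ∧
      (d < n → ∀ p ∈ absolutePoints, IsFoldPoint (d * m) (homogenization f) p) ∧
      (n < d → ∀ p ∈ absolutePoints, IsFoldPoint M (homogenization f) p) := by
  obtain ⟨c, hc, rfl⟩ := hS.exists_eq_C_mul hf
  have hne : polarPolynomial n d m M P ≠ 0 := by
    intro h
    exact hP.coeff_totalDegree hd (by rw [h, map_zero])
  rw [homogenization_C_mul hc, totalDegree_mul_of_isDomain (by simpa using hc) hne, totalDegree_C,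
    zero_add]
  have habs : ∀ p ∈ absolutePoints, ∃ ε : ℂ, ε ^ 2 = -1 ∧ p = ![0, 1, ε] := by
    rintro p (rfl | rfl)
    · exact ⟨Complex.I, Complex.I_sq, rfl⟩
    · exact ⟨-Complex.I, by rw [neg_sq, Complex.I_sq], rfl⟩
  refine ⟨hP.totalDegree_eq hd, (hP.isFoldPoint_origin hn hd).C_mul hc, fun h p hp => ?_,
    fun h p hp => ?_⟩
  · obtain ⟨ε, hε, rfl⟩ := habs p hp
    exact ((hP.isFoldPoint_absolute hn hd hε).1 h.le).C_mul hc
  · obtain ⟨ε, hε, rfl⟩ := habs p hp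
    exact ((hP.isFoldPoint_absolute hn hd hε).2 h.le).C_mul hc

end CurveEquation

/-! ### The equations of weight one and two -/

section PolarEquation

lemma coeff_comp_neg_X (p : Polynomial ℂ) (k : ℕ) :
    (p.comp (-Polynomial.X)).coeff k = p.coeff k * (-1) ^ k := by
  rw [← Polynomial.comp_C_mul_X_coeff]
  simp

/-- An even polynomial has no odd coefficients, so it is a polynomial in `x ^ 2`; this rewrites
functions of `ρ` in terms of `zw = ρ²`. -/
lemma eval_contract_two {p : Polynomial ℂ} (hp : p.comp (-Polynomial.X) = p) (x : ℂ) :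
    (Polynomial.contract 2 p).eval (x ^ 2) = p.eval x := by
  rw [← Polynomial.expand_eval]
  congr 1
  ext k
  rw [Polynomial.coeff_expand two_pos]
  split_ifs with h
  · rw [Polynomial.coeff_contract two_ne_zero, Nat.div_mul_cancel h]
  · have hk := congrArg (fun q => Polynomial.coeff q k) hp
    simp only [coeff_comp_neg_X] at hk
    rw [Odd.neg_one_pow (Nat.not_even_iff_odd.mp fun h' => h h'.two_dvd)] at hk
    linear_combination (1 / 2) * hk

lemma coeff_X_pow_mul_bounds {h : Polynomial ℂ} {l j : ℕ}
    (hj : (Polynomial.X ^ l * h).coeff j ≠ 0) : l ≤ j ∧ j ≤ l + h.natDegree := by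
  rw [Polynomial.coeff_X_pow_mul'] at hj
  split_ifs at hj with hlj
  · have := Polynomial.le_natDegree_of_ne_zero hj
    exact ⟨hlj, by omega⟩
  · exact absurd rfl hj

/-- The polynomial `2 ρ ^ n T_d (ρ - a)`, to which `z ^ n + w ^ n` is equal on the curve. -/
noncomputable def radialPolynomial (n d : ℕ) (a : ℝ) : Polynomial ℂ :=
  Polynomial.X ^ n *
    (Polynomial.C 2 * (Polynomial.Chebyshev.T ℂ d).comp (Polynomial.X - Polynomial.C (a : ℂ)))

lemma eval_radialPolynomial (n d : ℕ) (a : ℝ) (ρ : ℂ) :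
    (radialPolynomial n d a).eval ρ =
      2 * ρ ^ n * (Polynomial.Chebyshev.T ℂ d).eval (ρ - a) := by
  simp [radialPolynomial]
  ring

lemma natDegree_radialFactor (d : ℕ) (a : ℝ) : (Polynomial.C 2 *
    (Polynomial.Chebyshev.T ℂ d).comp (Polynomial.X - Polynomial.C (a : ℂ))).natDegree = d := by
  rw [Polynomial.natDegree_C_mul two_ne_zero, Polynomial.natDegree_comp,
    Polynomial.natDegree_X_sub_C, mul_one, Polynomial.Chebyshev.natDegree_T, Int.natAbs_natCast]

lemma radialPolynomial_coeff_bounds {n d : ℕ} {a : ℝ} {j : ℕ}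
    (hj : (radialPolynomial n d a).coeff j ≠ 0) : n ≤ j ∧ j ≤ n + d := by
  simpa only [natDegree_radialFactor] using coeff_X_pow_mul_bounds hj

lemma radialPolynomial_ne_zero (n d : ℕ) (a : ℝ) : radialPolynomial n d a ≠ 0 := by
  refine mul_ne_zero (pow_ne_zero _ Polynomial.X_ne_zero) (mul_ne_zero (by simp) fun h => ?_)
  -- At `ρ = 1 + a` the factor is `2 T_d(1) = 2`.
  have := congrArg (Polynomial.eval (1 + a : ℂ)) h
  simp at this

lemma natDegree_radialPolynomial (n d : ℕ) (a : ℝ) : (radialPolynomial n d a).natDegree = n + d := by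
  have h := radialPolynomial_ne_zero n d a
  rw [radialPolynomial] at h ⊢
  rw [Polynomial.natDegree_mul (left_ne_zero_of_mul h) (right_ne_zero_of_mul h),
    Polynomial.natDegree_X_pow, natDegree_radialFactor]

lemma natDegree_comp_neg_X (p : Polynomial ℂ) : (p.comp (-Polynomial.X)).natDegree = p.natDegree := by
  rw [Polynomial.natDegree_comp, Polynomial.natDegree_neg, Polynomial.natDegree_X, mul_one]

/-- The coefficients of the equation of degree one in `z ^ n + w ^ n`. -/
noncomputable def simpleFamily (n d : ℕ) (a : ℝ) : ℕ → Polynomial ℂ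
  | 0 => 1
  | _ => -Polynomial.contract 2 (radialPolynomial n d a)

/-- The coefficients of the equation of degree two in `z ^ n + w ^ n`. -/
noncomputable def normFamily (n d : ℕ) (a : ℝ) : ℕ → Polynomial ℂ
  | 0 => 1
  | 1 => -Polynomial.contract 2
      (radialPolynomial n d a + (radialPolynomial n d a).comp (-Polynomial.X))
  | _ => Polynomial.contract 2
      (radialPolynomial n d a * (radialPolynomial n d a).comp (-Polynomial.X))

lemma coeff_one_bounds {j : ℕ} (hj : (1 : Polynomial ℂ).coeff j ≠ 0) : j = 0 := by
  rw [Polynomial.coeff_one] at hj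
  by_contra h
  exact hj (if_neg h)

lemma isPolarFamily_simpleFamily {n d : ℕ} (a : ℝ) (hnd : Even (n + d)) :
    IsPolarFamily n d 1 ((n + d) / 2) (simpleFamily n d a) := by
  have hM : (n + d) / 2 * 2 = n + d := Nat.div_mul_cancel hnd.two_dvd
  have hb : ∀ k ≤ 1, ∀ j, (simpleFamily n d a k).coeff j ≠ 0 →
      n * k ≤ 2 * j ∧ 2 * j ≤ (n + d) * k := by
    intro k hk j hj
    interval_cases k
    · simp [coeff_one_bounds hj]
    · rw [simpleFamily, Polynomial.coeff_neg, Polynomial.coeff_contract two_ne_zero,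
        neg_ne_zero] at hj
      · have := radialPolynomial_coeff_bounds hj
        omega
      · simp
  refine ⟨by omega, fun k hk j hj => (hb k hk j hj).1, fun k hk j hj => (hb k hk j hj).2, rfl, ?_⟩
  rw [simpleFamily, Polynomial.coeff_neg, Polynomial.coeff_contract two_ne_zero, neg_ne_zero, hM]
  · have := Polynomial.leadingCoeff_ne_zero.mpr (radialPolynomial_ne_zero n d a)
    rwa [Polynomial.leadingCoeff, natDegree_radialPolynomial] at this
  · simp

lemma isPolarFamily_normFamily (n d : ℕ) (a : ℝ) :
    IsPolarFamily n d 2 (n + d) (normFamily n d a) := by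
  set G := radialPolynomial n d a with hG
  have hneg : ∀ j, (G.comp (-Polynomial.X)).coeff j ≠ 0 → n ≤ j ∧ j ≤ n + d := by
    intro j hj
    rw [coeff_comp_neg_X] at hj
    exact radialPolynomial_coeff_bounds (left_ne_zero_of_mul hj)
  have hne : G.comp (-Polynomial.X) ≠ 0 :=
    Polynomial.comp_neg_X_eq_zero_iff.not.mpr (radialPolynomial_ne_zero n d a)
  have hdeg : (G * G.comp (-Polynomial.X)).natDegree = (n + d) * 2 := by
    rw [Polynomial.natDegree_mul (radialPolynomial_ne_zero n d a), natDegree_comp_neg_X,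
      natDegree_radialPolynomial, mul_two]
    exact hne
  have hdvd : Polynomial.X ^ (2 * n) ∣ G * G.comp (-Polynomial.X) := by
    rw [two_mul, pow_add]
    refine mul_dvd_mul (Polynomial.X_pow_dvd_iff.mpr fun j hj => ?_)
      (Polynomial.X_pow_dvd_iff.mpr fun j hj => ?_)
    · by_contra h
      exact absurd (radialPolynomial_coeff_bounds h).1 (by omega)
    · by_contra h
      exact absurd (hneg j h).1 (by omega)
  have hb : ∀ k ≤ 2, ∀ j, (normFamily n d a k).coeff j ≠ 0 →
      n * k ≤ 2 * j ∧ 2 * j ≤ (n + d) * k := by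
    intro k hk j hj
    interval_cases k
    · simp [coeff_one_bounds hj]
    · rw [normFamily, Polynomial.coeff_neg, Polynomial.coeff_contract two_ne_zero,
        neg_ne_zero, Polynomial.coeff_add] at hj
      have : n ≤ j * 2 ∧ j * 2 ≤ n + d := by
        by_cases h : G.coeff (j * 2) = 0
        · rw [← hG, h, zero_add] at hj
          exact hneg _ hj
        · exact radialPolynomial_coeff_bounds h
      omega
    · rw [normFamily, Polynomial.coeff_contract two_ne_zero, ← hG] at hj
      · have h1 := Polynomial.le_natDegree_of_ne_zero hj
        rw [hdeg] at h1
        have h2 : 2 * n ≤ j * 2 := by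
          by_contra h
          exact hj (Polynomial.X_pow_dvd_iff.mp hdvd _ (not_le.mp h))
        omega
      · simp
      · simp
  refine ⟨by ring, fun k hk j hj => (hb k hk j hj).1, fun k hk j hj => (hb k hk j hj).2, rfl, ?_⟩
  rw [normFamily, Polynomial.coeff_contract two_ne_zero, ← hG, ← hdeg, Polynomial.coeff_natDegree,
    Polynomial.leadingCoeff_ne_zero]
  · exact mul_ne_zero (radialPolynomial_ne_zero n d a) hne
  · simp
  · simp

/-- For odd `n` and `d` both `ρ^n` and `T_d` are odd, so `G` is even and the sum is `G(ρ) - G(ρ)`.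
-/
lemma sum_simpleFamily {n d : ℕ} (hn : Odd n) (hd : Odd d) (ρ : ℂ) :
    ∑ k ∈ Finset.range (1 + 1), (2 * ρ ^ n *
      (Polynomial.Chebyshev.T ℂ d).eval (ρ - (0 : ℝ))) ^ (1 - k) *
        (simpleFamily n d 0 k).eval (ρ ^ 2) = 0 := by
  have heven : (radialPolynomial n d 0).comp (-Polynomial.X) = radialPolynomial n d 0 := by
    refine Polynomial.funext fun x => ?_
    rw [Polynomial.eval_comp, Polynomial.eval_neg, Polynomial.eval_X, eval_radialPolynomial,
      eval_radialPolynomial, Complex.ofReal_zero, sub_zero, sub_zero,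
      Polynomial.Chebyshev.T_eval_neg, Int.negOnePow_odd _ (by exact_mod_cast hd), hn.neg_pow]
    simp
  rw [Finset.sum_range_succ, Finset.sum_range_one, ← eval_radialPolynomial]
  simp [simpleFamily, eval_contract_two heven]

/-- With `S = G(ρ)` the sum is the expanded product `(S - G(ρ))(S - G(-ρ))`; its coefficients are
even in `ρ`. -/
lemma sum_normFamily (n d : ℕ) (a : ℝ) (ρ : ℂ) :
    ∑ k ∈ Finset.range (2 + 1), (2 * ρ ^ n *
      (Polynomial.Chebyshev.T ℂ d).eval (ρ - a)) ^ (2 - k) *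
        (normFamily n d a k).eval (ρ ^ 2) = 0 := by
  have hcomp : ((radialPolynomial n d a).comp (-Polynomial.X)).comp (-Polynomial.X) =
      radialPolynomial n d a := by
    simp [Polynomial.comp_assoc]
  rw [Finset.sum_range_succ, Finset.sum_range_succ, Finset.sum_range_one, ← eval_radialPolynomial]
  simp only [normFamily, Polynomial.eval_neg]
  rw [eval_contract_two (by rw [Polynomial.add_comp, hcomp, add_comm]),
    eval_contract_two (by rw [Polynomial.mul_comp, hcomp, mul_comm])]
  simp
  ring

lemma separatesRoots_one {n d : ℕ} (hnd : Nat.Coprime n d) :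
    SeparatesRoots n d 1 0 := by
  intro η h1 _ h3 _
  rw [mul_one] at h1
  rw [h1] at h3
  have := pow_gcd_eq_one.mpr ⟨h3.symm, h1⟩
  rwa [hnd, pow_one] at this

lemma separatesRoots_two {n d : ℕ} (hnd : Nat.Coprime n d) {a : ℝ}
    (h : ¬ (a = 0 ∧ Odd (n * d))) : SeparatesRoots n d 2 a := by
  intro η h1 h2 h3 h4
  rw [mul_comm] at h1
  -- `η^d = η^n` and `η^(n + d) = 1` give `η^(2n) = 1`; with `η^(2d) = 1` and coprimality, `η² = 1`.
  have hn2 : η ^ (2 * n) = 1 := by rw [two_mul, pow_add]; nth_rw 2 [← h3]; rwa [← pow_add]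
  have h5 := pow_gcd_eq_one.mpr ⟨hn2, h1⟩
  rw [Nat.gcd_mul_left, hnd, mul_one] at h5
  rcases sq_eq_one_iff.mp h5 with h6 | h6
  · exact h6
  · have hne : (-1 : ℂ) ≠ 1 := by norm_num
    rw [h6, neg_one_pow_eq_one_iff_even hne, Nat.even_add] at h2
    rw [h6, neg_one_pow_eq_one_iff_even hne] at h4
    have hde : ¬ Even d := fun hde => by
      have := Nat.dvd_gcd (h2.mpr hde).two_dvd hde.two_dvd
      rw [hnd] at this
      omega
    refine absurd ⟨h4.resolve_right hde, Nat.odd_mul.mpr ⟨?_, Nat.not_even_iff_odd.mp hde⟩⟩ h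
    exact Nat.not_even_iff_odd.mp fun hne => hde (h2.mp hne)

end PolarEquation

theorem theorem1 (n d : ℕ) (hn : 0 < n) (hd : 0 < d) (hnd : Nat.Coprime n d)
    (a : ℝ) (ha : 0 ≤ a) :
    (∃ f : MvPolynomial (Fin 2) ℂ, IsCurveEquation (cyclicHarmonicCurve n d a) f) ∧
    ∀ f : MvPolynomial (Fin 2) ℂ, IsCurveEquation (cyclicHarmonicCurve n d a) f →
      ((a = 0 ∧ Odd (n * d)) →
        f.totalDegree = n + d ∧
        IsFoldPoint n (homogenization f) originPoint ∧
        (d < n → ∀ p ∈ absolutePoints, IsFoldPoint d (homogenization f) p) ∧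
        (n < d → ∀ p ∈ absolutePoints, IsFoldPoint ((n + d) / 2) (homogenization f) p)) ∧
      (¬ (a = 0 ∧ Odd (n * d)) →
        f.totalDegree = 2 * (n + d) ∧
        IsFoldPoint (2 * n) (homogenization f) originPoint ∧
        (d < n → ∀ p ∈ absolutePoints, IsFoldPoint (2 * d) (homogenization f) p) ∧
        (n < d → ∀ p ∈ absolutePoints, IsFoldPoint (n + d) (homogenization f) p)) := by
  by_cases h : a = 0 ∧ Odd (n * d)
  · obtain ⟨rfl, hodd⟩ := h
    obtain ⟨hno, hdo⟩ := Nat.odd_mul.mp hodd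
    have hP := isPolarFamily_simpleFamily 0 (hno.add_odd hdo)
    have hS := hP.isCurveEquation (separatesRoots_one hnd) hn hd (one_dvd 2)
      (sum_simpleFamily hno hdo)
    refine ⟨⟨_, hS⟩, fun f hf => ⟨fun _ => ?_, fun h => absurd ⟨rfl, hodd⟩ h⟩⟩
    simpa only [mul_one] using hP.of_isCurveEquation hS hn hd hf
  · have hP := isPolarFamily_normFamily n d a
    have hS := hP.isCurveEquation (separatesRoots_two hnd h) hn hd dvd_rfl (sum_normFamily n d a)
    refine ⟨⟨_, hS⟩, fun f hf => ⟨fun h' => absurd h' h, fun _ => ?_⟩⟩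
    simpa only [mul_comm _ 2] using hP.of_isCurveEquation hS hn hd hf
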